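/- Throughout, graphs are finite and simple, $\mathbb{R}^+$ is the set of positive real numbers, and a weighted graph is a graph $G$ whose edges carry weights in $\mathbb{R}^+\cup\{\infty\}$. The distance $\mathrm{dist}_G(u,v)$ is the least total weight of a path from $u$ to $v$ in $G$ ($\infty$ if there is none); the weak diameter of $S\subseteq V(G)$ in $G$ is $\max_{u,v\in S}\mathrm{dist}_G(u,v)$; the radius of $G$ is $\min_u\max_v \mathrm{dist}_G(u,v)$. For $r>0$, $G^r$ is the graph on $V(G)$ in which distinct $u,v$ are adjacent iff $\mathrm{dist}_G(u,v)\le r$. An $(m,r,d)$-colouring of $G$ is a map from $V(G)$ to a set of $m$ colours such that every monochromatic $r$-component (a maximal nonempty connected subgraph of $G^r$ whose vertices all have the same colour) has a vertex set of weak diameter at most $d$ in $G$. For a real number $\ell\ge 0$ and an integer $n\ge 0$, a function $f:\mathbb{R}^+\to\mathbb{R}^+$ is an $\ell$-almost $n$-dimensional control function for $G$ if $G$ has an $(n+1,r,f(r))$-colouring for every real $r>0$ with $r\ge \ell$; it is one for a class of weighted graphs if it is one for each member of the class. A class is closed under (weight-preserving) isomorphism. A function $f:\mathbb{R}^+\to\mathbb{R}^+$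 is a dilation if there is $c>0$ with $f(r)\le cr$ for all $r>0$. A tree-decomposition of a graph $G$ is a family $(B_t:t\in V(T))$ of subsets of $V(G)$ (bags), indexed by the vertices of a tree $T$, such that for each $v\in V(G)$ the set $\{t: v\in B_t\}$ induces a nonempty connected subgraph of $T$, and both ends of each edge of $G$ lie in a common bag. It has adhesion at most $k$ if $|B_s\cap B_t|\le k$ for every edge $st$ of $T$. If $G$ is weighted, the weighted torso $G\langle B_t\rangle$ is the graph obtained from $G[B_t]$ by adding all edges $uv$ with $u\neq v$ and $u,v\in B_t\cap B_{t'}$ for some neighbour $t'$ of $t$ in $T$, where every edge $uv$ (old or new) gets weight $\mathrm{dist}_G(u,v)$. A partition $\mathcal{P}$ of $G$ is a partition of $V(G)$ into nonempty parts each inducing a connected subgraph of $G$; the quotient $G/\mathcal{P}$ is the graph with vertex set $\mathcal{P}$ in which two distinct parts are adjacent iff $G$ has an edge between them. $\mathcal{P}$ is $\ell$-shallow if $G[P]$ has radius at most $\ell$ for every $P\in\mathcal{P}$. For an integer $k\ge 0$, a real $\ell\ge 0$ and a class $\mathcal{H}$ of weighted graphs, a $(k,\ell,\mathcal{H})$-strong-construction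 of $G$ is a pair consisting of a partition $\mathcal{P}$ of $G$ and a tree-decomposition $(B_t:t\in V(T))$ of $G/\mathcal{P}$ such that (a) for every $t\in V(T)$ and every $\mathcal{P}_t\subseteq B_t$, the weighted graph $G\langle\bigcup_{P\in B_t}P\rangle\big[\bigcup_{P\in\mathcal{P}_t}P\big]$ is in $\mathcal{H}$, where the weighted torso is taken with respect to the tree-decomposition $(\bigcup_{P\in B_s}P:s\in V(T))$ of $G$; (b) $\mathcal{P}$ is $\ell$-shallow; (c) $(B_t:t\in V(T))$ has adhesion at most $k$. **Theorem.** For every integer $k\ge 0$ and every function $f:\mathbb{R}^+\to\mathbb{R}^+$ there exists a function $f_k:\mathbb{R}^+\to\mathbb{R}^+$ such that the following holds. Let $n\ge 0$ be an integer, let $\ell\ge 0$ be a real number, and let $\mathcal{H}$ be a class of weighted graphs for which $f$ is an $\ell$-almost $n$-dimensional control function. Then $f_k$ is an $\ell$-almost $\max(n,1)$-dimensional control function for every weighted graph that admits a $(k,\ell,\mathcal{H})$-strong-construction. Moreover, if $f$ is a dilation, then so is $f_k$. -/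

import Mathlib

open scoped ENNReal

universe u

/-- The strictly positive real numbers. -/
abbrev PosReal : Type := {x : ℝ // 0 < x}

/-- A function `f : ℝ⁺ → ℝ⁺` is a dilation if `f r ≤ c * r` for some `c > 0` and all `r > 0`. -/
def IsDilation (f : PosReal → PosReal) : Prop :=
  ∃ c : ℝ, 0 < c ∧ ∀ r : PosReal, (f r : ℝ) ≤ c * (r : ℝ)

/-- A (simple, undirected) graph whose edges carry weights in `(0, ∞]`. The values of `weight`
outside the edge set carry no meaning. -/
structure WeightedGraph (V : Type u) extends SimpleGraph V where
  weight : Sym2 V → ℝ≥0∞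
  weight_pos : ∀ e ∈ toSimpleGraph.edgeSet, 0 < weight e

namespace WeightedGraph

variable {V W ι : Type u}

/-- The sum of the weights of the edges of a walk. -/
def walkLength (G : WeightedGraph V) {x y : V} (p : G.toSimpleGraph.Walk x y) : ℝ≥0∞ :=
  (p.edges.map G.weight).sum

/-- The distance: the least length of a walk (equivalently, of a path, see
`dist_eq_iInf_path`), and `∞` if there is none. -/
noncomputable def dist (G : WeightedGraph V) (x y : V) : ℝ≥0∞ :=
  ⨅ p : G.toSimpleGraph.Walk x y, G.walkLength p

theorem walkLength_bypass_le [DecidableEq V] (G : WeightedGraph V) {x y : V}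
    (p : G.toSimpleGraph.Walk x y) : G.walkLength p.bypass ≤ G.walkLength p := by
  have hs : p.bypass.edges.Subperm p.edges :=
    (p.bypass_isPath.isTrail.edges_nodup).subperm p.edges_bypass_subset_edges
  obtain ⟨l, hl, hsub⟩ := hs
  unfold walkLength
  rw [← (hl.map G.weight).sum_eq]
  exact (hsub.map G.weight).sum_le_sum (fun _ _ => zero_le)

theorem dist_eq_iInf_path (G : WeightedGraph V) (x y : V) :
    G.dist x y = ⨅ p : G.toSimpleGraph.Path x y, G.walkLength p.1 := by
  classical
  apply le_antisymm
  · exact le_iInf fun p => iInf_le _ p.1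
  · exact le_iInf fun p =>
      (iInf_le _ (⟨p.bypass, p.bypass_isPath⟩ : G.toSimpleGraph.Path x y)).trans
        (G.walkLength_bypass_le p)

theorem dist_comm (G : WeightedGraph V) (x y : V) : G.dist x y = G.dist y x := by
  have key : ∀ a b : V, G.dist a b ≤ G.dist b a := fun a b =>
    le_iInf fun p => (iInf_le _ p.reverse).trans (by simp [walkLength])
  exact le_antisymm (key x y) (key y x)

theorem dist_pos [Finite V] (G : WeightedGraph V) {x y : V} (h : x ≠ y) : 0 < G.dist x y := by
  classical
  rw [dist_eq_iInf_path]
  have : Finite (G.toSimpleGraph.Path x y) := by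
    have := Fintype.ofFinite V
    infer_instance
  have hpos : ∀ p : G.toSimpleGraph.Path x y, 0 < G.walkLength p.1 := by
    rintro ⟨p, hp⟩
    cases p with
    | nil => exact absurd rfl h
    | cons hadj q =>
      simp only [walkLength, SimpleGraph.Walk.edges_cons, List.map_cons, List.sum_cons]
      exact lt_of_lt_of_le (G.weight_pos _ hadj) le_self_add
  rcases isEmpty_or_nonempty (G.toSimpleGraph.Path x y) with hE | hN
  · rw [iInf_of_empty]
    exact ENNReal.zero_lt_top
  · obtain ⟨p, hp⟩ := exists_eq_ciInf_of_finite
      (f := fun p : G.toSimpleGraph.Path x y => G.walkLength p.1)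
    rw [← hp]
    exact hpos p

/-- The weak diameter of a vertex set `S` in `G`. -/
noncomputable def weakDiam (G : WeightedGraph V) (S : Set V) : ℝ≥0∞ :=
  ⨆ x ∈ S, ⨆ y ∈ S, G.dist x y

/-- The radius of `G`. -/
noncomputable def radius (G : WeightedGraph V) : ℝ≥0∞ :=
  ⨅ x : V, ⨆ y : V, G.dist x y

/-- The induced weighted subgraph `G[S]`. -/
def induced (G : WeightedGraph V) (S : Set V) : WeightedGraph S where
  toSimpleGraph := G.toSimpleGraph.induce S
  weight e := G.weight (e.map Subtype.val)
  weight_pos := by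
    intro e
    induction e using Sym2.ind with
    | _ x y =>
      intro h
      exact G.weight_pos _ h

/-- Two weighted graphs are isomorphic if a graph isomorphism between them preserves the weights
of the edges. -/
def Isomorphic (G : WeightedGraph V) (G' : WeightedGraph W) : Prop :=
  ∃ φ : G.toSimpleGraph ≃g G'.toSimpleGraph,
    ∀ x y : V, G.Adj x y → G'.weight s(φ x, φ y) = G.weight s(x, y)

/-- The `r`-th power of `G`: distinct vertices are adjacent if they are at distance at most `r`
in `G`. -/
def power (G : WeightedGraph V) (r : ℝ) : SimpleGraph V where
  Adj x y := x ≠ y ∧ G.dist x y ≤ ENNReal.ofReal r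
  symm := ⟨fun x y h => ⟨h.1.symm, by rw [G.dist_comm]; exact h.2⟩⟩
  loopless := ⟨fun _ h => h.1 rfl⟩

/-- `M` is the vertex set of a monochromatic `r`-component of `G` under the colouring `c`: for
some colour `i`, it is maximal among the (nonempty) vertex sets of colour `i` that are connected
in the `r`-th power of `G`. -/
def IsMonochromaticComponent (G : WeightedGraph V) {m : ℕ} (c : V → Fin m) (r : ℝ)
    (M : Set V) : Prop :=
  ∃ i : Fin m,
    Maximal (fun S : Set V => (∀ x ∈ S, c x = i) ∧ ((G.power r).induce S).Connected) M

/-- `c` is an `(m, r, d)`-colouring of `G`. -/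
def IsColouring (G : WeightedGraph V) (m : ℕ) (r d : ℝ) (c : V → Fin m) : Prop :=
  ∀ M : Set V, G.IsMonochromaticComponent c r M → G.weakDiam M ≤ ENNReal.ofReal d

/-- `f` is an `ℓ`-almost `n`-dimensional control function for `G`. -/
def IsAlmostControlFunction (ℓ : ℝ) (n : ℕ) (f : PosReal → PosReal)
    (G : WeightedGraph V) : Prop :=
  ∀ r : PosReal, ℓ ≤ (r : ℝ) → ∃ c : V → Fin (n + 1), G.IsColouring (n + 1) r (f r) c

end WeightedGraph

/-- A class of finite weighted graphs, closed under isomorphism. -/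
structure WeightedGraphClass where
  Mem : ∀ {V : Type u} [Finite V], WeightedGraph V → Prop
  mem_of_isomorphic : ∀ {V W : Type u} [Finite V] [Finite W]
    (G : WeightedGraph V) (G' : WeightedGraph W), G.Isomorphic G' → Mem G → Mem G'

/-- `f` is an `ℓ`-almost `n`-dimensional control function for every member of the class. -/
def WeightedGraphClass.Admits (H : WeightedGraphClass.{u}) (ℓ : ℝ) (n : ℕ)
    (f : PosReal → PosReal) : Prop :=
  ∀ (V : Type u) [Finite V] (G : WeightedGraph V), H.Mem G →
    WeightedGraph.IsAlmostControlFunction ℓ n f G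

/-- The bags `B t`, indexed by the vertices `t` of `T`, form a tree-decomposition of `G`. -/
structure IsTreeDecomposition {V ι : Type u} (G : SimpleGraph V) (T : SimpleGraph ι)
    (B : ι → Set V) : Prop where
  isTree : T.IsTree
  connected : ∀ x : V, (T.induce {t | x ∈ B t}).Connected
  exists_bag : ∀ x y : V, G.Adj x y → ∃ t, x ∈ B t ∧ y ∈ B t

/-- The family of bags `B` indexed by `T` has adhesion at most `k`. -/
def AdhesionLE {V ι : Type u} (T : SimpleGraph ι) (B : ι → Set V) (k : ℕ) : Prop :=
  ∀ s t : ι, T.Adj s t → (B s ∩ B t).encard ≤ k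

namespace WeightedGraph

variable {V ι : Type u}

/-- The weighted torso of `G` at `t` with respect to the bags `B` indexed by `T`: the induced
subgraph on `B t`, together with all edges inside `B t ∩ B t'` for the neighbours `t'` of `t`,
every edge being weighted by the distance of its ends in the whole graph `G`. -/
noncomputable def torso [Finite V] (G : WeightedGraph V) (T : SimpleGraph ι) (B : ι → Set V)
    (t : ι) : WeightedGraph (B t) where
  Adj x y := x ≠ y ∧
    (G.Adj x y ∨ ∃ t' : ι, T.Adj t t' ∧ (x : V) ∈ B t' ∧ (y : V) ∈ B t')
  symm := ⟨by
    rintro x y ⟨hne, h | ⟨t', ht, hx, hy⟩⟩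
    · exact ⟨hne.symm, Or.inl h.symm⟩
    · exact ⟨hne.symm, Or.inr ⟨t', ht, hy, hx⟩⟩⟩
  loopless := ⟨fun _ h => h.1 rfl⟩
  weight := Sym2.lift ⟨fun x y => G.dist x y, fun x y => G.dist_comm x y⟩
  weight_pos := by
    intro e
    induction e using Sym2.ind with
    | _ x y =>
      intro h
      exact G.dist_pos (fun hxy => h.1 (Subtype.ext hxy))

/-- `P` is a partition of `V(G)` into nonempty parts inducing connected subgraphs of `G`. -/
structure IsPartition (G : WeightedGraph V) (P : Set (Set V)) : Prop where
  isPartition : Setoid.IsPartition P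
  connected : ∀ S ∈ P, (G.toSimpleGraph.induce S).Connected

/-- The quotient `G / P`: its vertices are the parts; distinct parts are adjacent if `G` has an
edge between them. -/
def quotient (G : WeightedGraph V) (P : Set (Set V)) : SimpleGraph P where
  Adj X Y := X ≠ Y ∧ ∃ x ∈ (X : Set V), ∃ y ∈ (Y : Set V), G.Adj x y
  symm := ⟨fun _ _ ⟨hne, x, hx, y, hy, h⟩ => ⟨hne.symm, y, hy, x, hx, h.symm⟩⟩
  loopless := ⟨fun _ h => h.1 rfl⟩

/-- Every part induces a weighted subgraph of radius at most `ℓ`. -/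
def IsShallow (G : WeightedGraph V) (ℓ : ℝ) (P : Set (Set V)) : Prop :=
  ∀ S ∈ P, (G.induced S).radius ≤ ENNReal.ofReal ℓ

end WeightedGraph

/-- The union of a set of parts. -/
def unionOfParts {V : Type u} {P : Set (Set V)} (Q : Set P) : Set V :=
  {x | ∃ X ∈ Q, x ∈ (X : Set V)}

namespace WeightedGraph

variable {V ι : Type u}

/-- The partition `P` of `G` and the bags `B` indexed by the tree `T` form a
`(k, ℓ, H)`-strong-construction of `G`. -/
structure IsStrongConstruction [Finite V] (k : ℕ) (ℓ : ℝ) (H : WeightedGraphClass.{u})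
    (G : WeightedGraph V) (P : Set (Set V)) (T : SimpleGraph ι) (B : ι → Set P) : Prop where
  isPartition : G.IsPartition P
  isTreeDecomposition : IsTreeDecomposition (G.quotient P) T B
  mem : ∀ (t : ι) (Q : Set P), Q ⊆ B t →
    H.Mem ((G.torso T (fun s => unionOfParts (B s)) t).induced {x | x.1 ∈ unionOfParts Q})
  isShallow : G.IsShallow ℓ P
  adhesion : AdhesionLE T B k

/-- `G` admits a `(k, ℓ, H)`-strong-construction (over some finite tree). -/
def IsStronglyConstructable [Finite V] (k : ℕ) (ℓ : ℝ) (H : WeightedGraphClass.{u})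
    (G : WeightedGraph V) : Prop :=
  ∃ (P : Set (Set V)) (ι : Type u) (_ : Finite ι) (T : SimpleGraph ι) (B : ι → Set P),
    IsStrongConstruction k ℓ H G P T B

end WeightedGraph

/-! Parts are coloured instead of vertices. A part is represented by its centre, and as its radius
is at most `ℓ ≤ r`, this costs only multiples of `r`. Lengths are measured by `torsoWeight`, which
adds all adhesion cliques to `G`, weighted by distances of `G`. No distance changes, but the union
of the bags of a subtree becomes convex: an excursion across an adhesion set is replaced by one
clique edge (`Reach.shortcut`).

The core is an induction on the adhesion bound. Let `U` be glued from bags along sets of at most `k`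
parts, let `X` be the root bag and `N₀` the ball of radius `7 * r` around `X`. Going down from the
root, cut at the adhesion sets that avoid `N₀` (`Glued.truncate`). Every adhesion set inside the
remainder `U₀` meets `N₀`, so `U₀ \ N₀` has smaller adhesion and is coloured by induction. Its bags
are subsets of the old ones, which is why the construction needs all sub-bags to be in the class.
Points near `X` copy a colouring of `X`. Together this colours `U₀` at a scale `ρ` that exceeds `r`
by a suitable factor (`exists_colouring_of_near_root`).

Each piece cut off hangs on `U₀` at a set of at most `k` parts inside its own root bag, and has
fewer bags. A second induction, on the number of bags, colours such pieces with prescribed colours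
on a small subset `A` of the root bag (`Glued.exists_extension`). Points near `A` copy colours from
`A` and are surrounded by two rings of different colours, which no monochromatic chain starting near
`A` can cross (`Shielded.confined`). The rings need two colours, hence the dimension `max n 1`. A
monochromatic chain that meets or approaches `U₀` then leaves a trace in `U₀` with steps at most
`ρ`, and any other chain stays in one piece (`bdd_of_hanging`). -/

/-! ### Route systems and monochromatic chains. -/

/-- Abstract routes between the elements of `V`, where `V` is divided into parts indexed by `P`:
`Route U s x y` says that `x` and `y` are joined by a route of length at most `s` that stays inside
the parts of `U`. Every part has a centre, at distance at most `ℓ` inside the part. -/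
structure RouteSystem (P : Type u) (ℓ : ℝ) where
  V : Type u
  part : V → P
  centre : P → V
  part_centre : ∀ p, part (centre p) = p
  error_nonneg : 0 ≤ ℓ
  Route : Set P → ℝ → V → V → Prop
  route_refl : ∀ {U : Set P} {s : ℝ} {x : V}, part x ∈ U → 0 ≤ s → Route U s x x
  route_symm : ∀ {U : Set P} {s : ℝ} {x y : V}, Route U s x y → Route U s y x
  route_trans : ∀ {U : Set P} {s s' : ℝ} {x y z : V},
    Route U s x y → Route U s' y z → Route U (s + s') x z
  route_mono : ∀ {U U' : Set P} {s s' : ℝ} {x y : V},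
    U ⊆ U' → s ≤ s' → Route U s x y → Route U' s' x y
  route_nonneg : ∀ {U : Set P} {s : ℝ} {x y : V}, Route U s x y → 0 ≤ s
  route_mem : ∀ {U : Set P} {s : ℝ} {x y : V}, Route U s x y → part x ∈ U
  route_centre : ∀ x, Route {part x} ℓ x (centre (part x))
  route_split : ∀ {U U' : Set P} {s : ℝ} {x y : V}, part x ∈ U' → Route U s x y →
    Route U' s x y ∨ ∃ z s₁ s₂, part z ∈ U \ U' ∧ Route U s₁ x z ∧ Route U s₂ z y ∧ s₁ + s₂ ≤ s

namespace RouteSystem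

variable {P : Type u} {ℓ : ℝ} {C : Type}

/-- The centres of `p` and `q` are joined by a route of length at most `s` inside `U`. -/
def Near (N : RouteSystem P ℓ) (U : Set P) (s : ℝ) (p q : P) : Prop :=
  N.Route U s (N.centre p) (N.centre q)

section

variable (N : RouteSystem P ℓ) {U U' : Set P} {s s' : ℝ} {p q z : P}

theorem refl (hp : p ∈ U) (hs : 0 ≤ s) : N.Near U s p p :=
  N.route_refl (by rwa [N.part_centre]) hs

theorem symm (h : N.Near U s p q) : N.Near U s q p := N.route_symm h

theorem trans (h : N.Near U s p q) (h' : N.Near U s' q z) : N.Near U (s + s') p z :=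
  N.route_trans h h'

theorem mono (hU : U ⊆ U') (hs : s ≤ s') (h : N.Near U s p q) : N.Near U' s' p q :=
  N.route_mono hU hs h

theorem nonneg (h : N.Near U s p q) : 0 ≤ s := N.route_nonneg h

theorem mem (h : N.Near U s p q) : p ∈ U := by
  have := N.route_mem h
  rwa [N.part_centre] at this

/-- The point where the route leaves `U'` need not be a centre; the detour to the centre of its part
costs `ℓ` on each side. -/
theorem split (hp : p ∈ U') (h : N.Near U s p q) :
    N.Near U' s p q ∨ ∃ z ∈ U \ U', N.Near U (s + ℓ) p z ∧ N.Near U (s + ℓ) z q := by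
  rcases N.route_split (by rwa [N.part_centre]) h with h | ⟨z, s₁, s₂, hz, h₁, h₂, hs⟩
  · exact .inl h
  · have hc : N.Route U ℓ z (N.centre (N.part z)) :=
      N.route_mono (by simpa using hz.1) le_rfl (N.route_centre z)
    have hn₁ := N.route_nonneg h₁
    have hn₂ := N.route_nonneg h₂
    exact .inr ⟨_, hz, N.route_mono subset_rfl (by linarith) (N.route_trans h₁ hc),
      N.route_mono subset_rfl (by linarith) (N.route_trans (N.route_symm hc) h₂)⟩

end

theorem Near.le (N : RouteSystem P ℓ) {U : Set P} {s s' : ℝ} {p q : P} (h : N.Near U s p q)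
    (hs : s ≤ s') : N.Near U s' p q :=
  N.mono subset_rfl hs h

/-- `p` and `q` are joined by a monochromatic chain of elements of `S` with steps of length at most
`s`, measured in `U`. -/
def Conn (N : RouteSystem P ℓ) (U S : Set P) (s : ℝ) (c : P → C) : P → P → Prop :=
  Relation.ReflTransGen (fun a b => a ∈ S ∧ b ∈ S ∧ c a = c b ∧ N.Near U s a b)

/-- Monochromatic chains in `S` with steps at most `s` have ends at distance at most `D`. -/
def Bdd (N : RouteSystem P ℓ) (U S : Set P) (s : ℝ) (c : P → C) (D : ℝ) : Prop :=
  ∀ p q, p ∈ S → N.Conn U S s c p q → N.Near U D p q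

variable (N : RouteSystem P ℓ) {U S M X : Set P} {s D D₁ D₂ : ℝ} {c : P → C} {p q : P}

theorem Conn.symm (h : N.Conn U S s c p q) : N.Conn U S s c q p := by
  induction h with
  | refl => exact .refl
  | tail _ hbc ih => exact .head ⟨hbc.2.1, hbc.1, hbc.2.2.1.symm, N.symm hbc.2.2.2⟩ ih

theorem Conn.color_eq (h : N.Conn U S s c p q) : c p = c q := by
  induction h with
  | refl => rfl
  | tail _ hbc ih => exact ih.trans hbc.2.2.1

theorem Conn.mem (h : N.Conn U S s c p q) (hp : p ∈ S) : q ∈ S := by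
  cases h with
  | refl => exact hp
  | tail _ hbc => exact hbc.2.1

/-- Between visits to `M` a chain runs in `S` and moves by at most `D₁`. With one step out and one
step back, the visits form a chain in `M` with steps at most `D₁ + 2 * s`. The factor 2 comes from
comparing both ends with one visit. -/
theorem Bdd.union (hs : 0 ≤ s) (hD₁ : 0 ≤ D₁) (hD₂ : 0 ≤ D₂)
    (hS : N.Bdd U S s c D₁) (hM : N.Bdd U M (D₁ + 2 * s) c D₂) :
    N.Bdd U (S ∪ M) s c (2 * (D₁ + D₂ + s)) := by
  -- Here `u` is the last visit to `M`, and the chain from `w` to `q` is the stretch in `S` since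
  -- then.
  have key : ∀ p q, p ∈ M → N.Conn U (S ∪ M) s c p q →
      ∃ u ∈ M, N.Conn U M (D₁ + 2 * s) c p u ∧
        (q = u ∨ ∃ w ∈ S, N.Near U s u w ∧ N.Conn U S s c w q) := by
    intro p q hp h
    induction h with
    | refl => exact ⟨p, hp, .refl, .inl rfl⟩
    | @tail v w hv hvw ih =>
      obtain ⟨u, huM, hpu, hu⟩ := ih
      have hcol : c u = c w :=
        ((Conn.color_eq N hpu).symm.trans (Conn.color_eq N hv)).trans hvw.2.2.1
      by_cases hwM : w ∈ M
      · refine ⟨w, hwM, hpu.tail ⟨huM, hwM, hcol, ?_⟩, .inl rfl⟩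
        rcases hu with rfl | ⟨x, hxS, hux, hxv⟩
        · exact Near.le N hvw.2.2.2 (by linarith)
        · exact Near.le N (N.trans (N.trans hux (hS _ _ hxS hxv)) hvw.2.2.2) (by linarith)
      · have hwS : w ∈ S := hvw.2.1.resolve_right hwM
        rcases hu with rfl | ⟨x, hxS, hux, hxv⟩
        · exact ⟨v, huM, hpu, .inr ⟨w, hwS, hvw.2.2.2, .refl⟩⟩
        · exact ⟨u, huM, hpu, .inr ⟨x, hxS, hux,
            hxv.tail ⟨Conn.mem N hxv hxS, hwS, hvw.2.2⟩⟩⟩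
  have key2 : ∀ p q, p ∈ M → N.Conn U (S ∪ M) s c p q → N.Near U (D₁ + D₂ + s) p q := by
    intro p q hp h
    obtain ⟨u, huM, hpu, rfl | ⟨w, hwS, huw, hwq⟩⟩ := key p q hp h
    · exact Near.le N (hM _ _ hp hpu) (by linarith)
    · exact Near.le N (N.trans (N.trans (hM _ _ hp hpu) huw) (hS _ _ hwS hwq)) (by linarith)
  have key3 : ∀ p q, p ∈ S ∪ M → N.Conn U (S ∪ M) s c p q →
      (p ∈ S ∧ N.Conn U S s c p q) ∨
        ∃ v ∈ M, N.Conn U (S ∪ M) s c p v ∧ N.Conn U (S ∪ M) s c v q := by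
    intro p q hp h
    induction h with
    | refl =>
      rcases hp with hp | hp
      · exact .inl ⟨hp, .refl⟩
      · exact .inr ⟨p, hp, .refl, .refl⟩
    | @tail v w hv hvw ih =>
      rcases ih with ⟨hpS, hpv⟩ | ⟨x, hx, hpx, hxv⟩
      · rcases hvw.2.1 with hw | hw
        · exact .inl ⟨hpS, hpv.tail ⟨Conn.mem N hpv hpS, hw, hvw.2.2⟩⟩
        · exact .inr ⟨w, hw, hv.tail hvw, .refl⟩
      · exact .inr ⟨x, hx, hpx, hxv.tail hvw⟩
  intro p q hp h
  rcases key3 p q hp h with ⟨hpS, h⟩ | ⟨v, hv, hpv, hvq⟩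
  · exact Near.le N (hS _ _ hpS h) (by linarith)
  · exact Near.le N (N.trans (N.symm (key2 _ _ hv (Conn.symm N hpv))) (key2 _ _ hv hvq))
      (by linarith)

/-- The map `h` acts as a retraction to `X` that respects colours: moving both ends of a step by at
most `b` lengthens it by at most `2 * b`. -/
theorem Bdd.transport {C' : Type} {c' : P → C'} {b : ℝ} (h : P → P)
    (hX : ∀ p ∈ M, h p ∈ X) (hb : ∀ p ∈ M, N.Near U b (h p) p)
    (hc : ∀ p ∈ M, ∀ q ∈ M, c p = c q → c' (h p) = c' (h q))
    (hbd : N.Bdd U X (s + 2 * b) c' D) : N.Bdd U M s c (D + 2 * b) := by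
  intro p q hp hpq
  have hq := Conn.mem N hpq hp
  have : N.Conn U X (s + 2 * b) c' (h p) (h q) := by
    clear hq
    induction hpq with
    | refl => exact .refl
    | tail _ hvw ih =>
      refine ih.tail ⟨hX _ hvw.1, hX _ hvw.2.1, hc _ hvw.1 _ hvw.2.1 hvw.2.2.1, ?_⟩
      exact Near.le N (N.trans (N.trans (hb _ hvw.1) hvw.2.2.2) (N.symm (hb _ hvw.2.1)))
        (by linarith)
  exact Near.le N (N.trans (N.trans (N.symm (hb _ hp)) (hbd _ _ (hX _ hp) this)) (hb _ hq))
    (by linarith)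

theorem Bdd.congr {c' : P → C} (hc : ∀ p ∈ S, c p = c' p) (h : N.Bdd U S s c D) :
    N.Bdd U S s c' D := by
  intro p q hp hpq
  refine h p q hp (Relation.ReflTransGen.mono ?_ _ _ hpq)
  rintro a b ⟨ha, hb, hab, h⟩
  exact ⟨ha, hb, by rw [hc a ha, hc b hb, hab], h⟩

/-- A path on at most `k` points has fewer than `k` steps, so smallness alone gives the bound,
whatever the colouring. -/
theorem bdd_of_ncard_le [Finite P] {k : ℕ} (hXU : X ⊆ U) (hk : X.ncard ≤ k) (hs : 0 ≤ s) :
    N.Bdd U X s c (k * s) := by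
  classical
  intro p q hp hpq
  let Γ : SimpleGraph X := SimpleGraph.fromRel (fun a b => N.Near U s a b)
  have hwalk : ∀ {a b : X} (w : Γ.Walk a b), N.Near U (w.length * s) a b := by
    intro a b w
    induction w with
    | nil => exact N.refl (hXU (Subtype.mem _)) (by simp)
    | cons hadj w ih =>
      have h1 := ((SimpleGraph.fromRel_adj _ _ _).1 hadj).2
      have h2 : N.Near U s _ _ := h1.elim id N.symm
      refine Near.le N (N.trans h2 ih) ?_
      rw [SimpleGraph.Walk.length_cons]
      push_cast
      linarith
  have hreach : ∀ q, N.Conn U X s c p q → ∀ hq : q ∈ X, Γ.Reachable ⟨p, hp⟩ ⟨q, hq⟩ := by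
    intro q h
    induction h with
    | refl => exact fun _ => .refl _
    | @tail v w hv hvw ih =>
      intro hw
      refine (ih hvw.1).trans ?_
      by_cases hne : v = w
      · subst hne; exact .refl _
      · refine SimpleGraph.Adj.reachable ((SimpleGraph.fromRel_adj _ _ _).2 ⟨?_, .inl hvw.2.2.2⟩)
        exact fun h => hne (congrArg Subtype.val h)
  obtain ⟨w⟩ := hreach q hpq (Conn.mem N hpq hp)
  have := Fintype.ofFinite X
  have hlen := w.bypass_isPath.length_lt
  rw [← Nat.card_eq_fintype_card, Nat.card_coe_set_eq] at hlen
  refine Near.le N (hwalk w.bypass) (mul_le_mul_of_nonneg_right ?_ hs)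
  exact_mod_cast hlen.le.trans hk

/-! ### Convexity, separation and gluing. -/

/-- `S` is convex in `W`: routes in `W` between elements of `S` can be replaced by routes in `S` that
are not longer and visit no new places. -/
def Convex (S W : Set P) : Prop :=
  ∀ (Y : Set P) (s : ℝ) (x y : N.V), N.part x ∈ S → N.part y ∈ S →
    N.Route (W ∩ Y) s x y → N.Route (S ∩ Y) s x y

/-- Every route in `U ∪ U'` from `U` to `U'` passes through `U ∩ U'`. -/
def Separated (U U' : Set P) : Prop :=
  ∀ (Y : Set P) (s : ℝ) (x y : N.V), Y ⊆ U ∪ U' → Disjoint Y (U ∩ U') → N.part x ∈ U →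
    N.part y ∈ U' → ¬ N.Route Y s x y

variable {N}

theorem Convex.rfl : N.Convex S S := fun _ _ _ _ _ _ h => h

theorem Convex.near_inter {W Y : Set P} (h : N.Convex S W) (hp : p ∈ S) (hq : q ∈ S)
    (hn : N.Near (W ∩ Y) s p q) : N.Near (S ∩ Y) s p q :=
  h Y s _ _ (by rwa [N.part_centre]) (by rwa [N.part_centre]) hn

theorem Convex.near {W : Set P} (h : N.Convex S W) (hp : p ∈ S) (hq : q ∈ S)
    (hn : N.Near W s p q) : N.Near S s p q := by
  have := h.near_inter (Y := Set.univ) hp hq (by rwa [Set.inter_univ])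
  rwa [Set.inter_univ] at this

theorem Separated.not_near {U U' Y : Set P} (h : N.Separated U U') (hY : Y ⊆ U ∪ U')
    (hd : Disjoint Y (U ∩ U')) (hp : p ∈ U) (hq : q ∈ U') : ¬ N.Near Y s p q :=
  h Y s _ _ hY hd (by rwa [N.part_centre]) (by rwa [N.part_centre])

theorem Convex.trans {W W' : Set P} (h : N.Convex S W) (hSW : S ⊆ W) (h' : N.Convex W W') :
    N.Convex S W' :=
  fun Y s p q hp hq hn => h Y s p q hp hq (h' Y s p q (hSW hp) (hSW hq) hn)

theorem Separated.symm {U U' : Set P} (h : N.Separated U U') : N.Separated U' U := by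
  intro Y s p q hY hd hp hq hn
  exact h Y s q p (by rwa [Set.union_comm]) (by rwa [Set.inter_comm]) hq hp (N.route_symm hn)

end RouteSystem

/-- Sets that are built by gluing good bags along a tree, where `X` is the bag at the root, `n` is
the number of bags, and all adhesion sets have fewer than `k` elements. -/
inductive RouteSystem.Glued {P : Type u} {ℓ : ℝ} (N : RouteSystem P ℓ) (good : Set P → Prop) (k : ℕ) :
    ℕ → Set P → Set P → Prop
  | bag {X : Set P} : good X → Glued N good k 1 X X
  | glue {m n : ℕ} {U X U' X' : Set P} : Glued N good k m U X → Glued N good k n U' X' →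
      U ∩ U' ⊆ X ∩ X' → (U ∩ U').ncard < k → N.Separated U U' →
      N.Convex U (U ∪ U') → N.Convex U' (U ∪ U') → Glued N good k (m + n) (U ∪ U') X

namespace RouteSystem

variable {P : Type u} {ℓ : ℝ} {N : RouteSystem P ℓ} {good : Set P → Prop}

theorem Glued.pos {k n : ℕ} {U X : Set P} (h : N.Glued good k n U X) : 0 < n := by
  induction h <;> omega

theorem Glued.root_subset {k n : ℕ} {U X : Set P} (h : N.Glued good k n U X) : X ⊆ U := by
  induction h with
  | bag => exact subset_rfl
  | glue _ _ _ _ _ _ _ ih _ => exact ih.trans Set.subset_union_left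

theorem Glued.good_root {k n : ℕ} {U X : Set P} (h : N.Glued good k n U X) : good X := by
  induction h with
  | bag h => exact h
  | glue _ _ _ _ _ _ _ ih _ => exact ih

theorem Glued.convex_root {k n : ℕ} {U X : Set P} (h : N.Glued good k n U X) : N.Convex X U := by
  induction h with
  | bag h => exact .rfl
  | glue h _ _ _ _ hc _ ih _ => exact ih.trans h.root_subset hc

/-! ### Cutting off the pieces far from the root. -/

/-- `Y` hangs at the part `U₀` of `U`, along an adhesion set that avoids `N₀`. -/
structure IsHanging (N : RouteSystem P ℓ) (good : Set P → Prop) (k n : ℕ) (N₀ U U₀ Y : Set P) :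
    Prop where
  subset : Y ⊆ U
  glued : ∃ m < n, ∃ X, N.Glued good k m Y X ∧ Y ∩ U₀ ⊆ X
  ncard_lt : (Y ∩ U₀).ncard < k
  disjoint : Disjoint (Y ∩ U₀) N₀
  convex : N.Convex Y U
  separated : ∀ (Z : Set P) (s : ℝ) (p q : P), Z ⊆ U → Disjoint Z (Y ∩ U₀) → p ∉ Y → q ∈ Y →
    ¬ N.Near Z s p q

/-- A route reaching `Y` from `U'` crosses `U ∩ U' ⊆ U₀`, and from there convexity of `U` reduces it
to a route in `U`. The set `V` is what the truncation of the other side contributes; it may be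
empty. -/
theorem IsHanging.extend {k n n' : ℕ} {N₀ U U' U₀ Y V : Set P}
    (h : IsHanging N good k n N₀ U U₀ Y) (hn : n ≤ n') (hUU : U ∩ U' ⊆ U₀)
    (hV : V ∩ U ⊆ U₀) (hc : N.Convex U (U ∪ U')) (hs : N.Separated U U') :
    IsHanging N good k n' N₀ (U ∪ U') (U₀ ∪ V) Y := by
  have hY : Y ∩ (U₀ ∪ V) = Y ∩ U₀ := by
    ext x
    constructor
    · rintro ⟨hx, hx' | hx'⟩
      · exact ⟨hx, hx'⟩
      · exact ⟨hx, hV ⟨hx', h.subset hx⟩⟩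
    · exact fun hx => ⟨hx.1, .inl hx.2⟩
  refine ⟨h.subset.trans Set.subset_union_left, ?_, by rw [hY]; exact h.ncard_lt,
    by rw [hY]; exact h.disjoint, h.convex.trans h.subset hc, ?_⟩
  · obtain ⟨m, hm, X, hX⟩ := h.glued
    exact ⟨m, hm.trans_le hn, X, by rw [hY]; exact hX⟩
  · rw [hY]
    have inU : ∀ (Z : Set P) (s : ℝ) (p q : P), Z ⊆ U ∪ U' → Disjoint Z (Y ∩ U₀) → p ∈ U →
        p ∉ Y → q ∈ Y → ¬ N.Near Z s p q := by
      intro Z s p q hZ hd hpU hp hq hn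
      have h1 := hc.near_inter (Y := Z) hpU (h.subset hq) (by rwa [Set.inter_eq_self_of_subset_right hZ])
      exact h.separated _ s p q Set.inter_subset_left (hd.mono_left Set.inter_subset_right) hp hq h1
    intro Z s p q hZ hd hp hq hn
    by_cases hpU : p ∈ U
    · exact inU Z s p q hZ hd hpU hp hq hn
    have hqZ := N.mem (N.symm hn)
    have hqU' : q ∉ U' := fun hqU' =>
      Set.disjoint_left.1 hd hqZ ⟨hq, hUU ⟨h.subset hq, hqU'⟩⟩
    have hpU' : p ∈ U' := (hZ (N.mem hn)).resolve_left hpU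
    rcases N.split (U' := Z \ (U ∩ U')) ⟨N.mem hn, fun h => hpU h.1⟩ hn with h1 | ⟨z, hz, -, hzq⟩
    · exact hs.not_near (Set.sdiff_subset.trans hZ) Set.disjoint_sdiff_left (h.subset hq) hpU'
        (N.symm h1)
    · have hzU : z ∈ U ∩ U' := by
        by_contra hcon
        exact hz.2 ⟨hz.1, hcon⟩
      exact inU Z _ z q hZ hd hzU.1
        (fun hzY => Set.disjoint_left.1 hd hz.1 ⟨hzY, hUU hzU⟩) hq hzq

/-- Recursion along the gluing. Where the adhesion set avoids `N₀`, the whole far side is hung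
there. Where it meets `N₀`, both truncated sides are kept, and deleting `N₀` removes at least one
part from the adhesion set. -/
theorem Glued.truncate [Finite P] {k n : ℕ} {U X : Set P} (h : N.Glued good (k + 1) n U X)
    (hgood : ∀ X Y, good X → Y ⊆ X → good Y) (N₀ : Set P) :
    ∃ (U₀ : Set P) (E : Set (Set P)), X ⊆ U₀ ∧ U₀ ⊆ U ∧ N.Convex U₀ U ∧
      (∃ m, N.Glued good k m (U₀ \ N₀) (X \ N₀)) ∧
      (∀ p ∈ U, p ∉ U₀ → ∃ Y ∈ E, p ∈ Y) ∧
      (∀ Y ∈ E, IsHanging N good (k + 1) n N₀ U U₀ Y) ∧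
      (∀ Y ∈ E, ∀ Y' ∈ E, Y ≠ Y' → Y ∩ Y' ⊆ U₀) := by
  induction h with
  | @bag X hX =>
    exact ⟨X, ∅, subset_rfl, subset_rfl, .rfl, ⟨1, .bag (hgood _ _ hX Set.sdiff_subset)⟩,
      fun p hp hp' => absurd hp hp', by simp, by simp⟩
  | @glue m n U X U' X' hU hU' hsub hcard hsep hcU hcU' ih ih' =>
    obtain ⟨U₁, E₁, hX₁, hU₁, hc₁, ⟨m₁, hd₁⟩, hcov₁, hE₁, hdis₁⟩ := ih
    obtain ⟨U₂, E₂, hX₂, hU₂, hc₂, ⟨m₂, hd₂⟩, hcov₂, hE₂, hdis₂⟩ := ih'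
    have hA₁ : U ∩ U' ⊆ U₁ := fun x hx => hX₁ (hsub hx).1
    have hA₂ : U ∩ U' ⊆ U₂ := fun x hx => hX₂ (hsub hx).2
    by_cases hN : Disjoint (U ∩ U') N₀
    · refine ⟨U₁, insert U' E₁, hX₁, hU₁.trans Set.subset_union_left, hc₁.trans hU₁ hcU,
        ⟨m₁, hd₁⟩, ?_, ?_, ?_⟩
      · rintro p (hp | hp) hp'
        · obtain ⟨Y, hY, hpY⟩ := hcov₁ p hp hp'
          exact ⟨Y, .inr hY, hpY⟩
        · exact ⟨U', .inl rfl, hp⟩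
      · rintro Y (rfl | hY)
        · have hAeq : Y ∩ U₁ = U ∩ Y :=
            Set.Subset.antisymm (fun x hx => ⟨hU₁ hx.2, hx.1⟩) fun x hx => ⟨hx.2, hA₁ hx⟩
          refine ⟨Set.subset_union_right,
            ⟨n, by have := hU.pos; omega, X', hU', by rw [hAeq]; exact fun x hx => (hsub hx).2⟩,
            by rw [hAeq]; exact hcard, by rw [hAeq]; exact hN, hcU', ?_⟩
          intro Z s p q hZ hd hp hq hn
          rw [hAeq] at hd
          exact hsep.not_near hZ hd ((hZ (N.mem hn)).resolve_right hp) hq hn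
        · simpa using (hE₁ Y hY).extend (V := ∅) (by omega) hA₁ (by simp) hcU hsep
      · rintro Y (rfl | hY) Y' (rfl | hY') hne
        · exact absurd rfl hne
        · exact fun x hx => hA₁ ⟨(hE₁ _ hY').subset hx.2, hx.1⟩
        · exact fun x hx => hA₁ ⟨(hE₁ _ hY).subset hx.1, hx.2⟩
        · exact hdis₁ Y hY Y' hY' hne
    -- The adhesion set lies in both root bags, so neither truncation touches it.
    · have hint : U₁ ∩ U₂ = U ∩ U' := Set.Subset.antisymm
        (fun x hx => ⟨hU₁ hx.1, hU₂ hx.2⟩) fun x hx => ⟨hA₁ hx, hA₂ hx⟩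
      have e₁ : U ∩ (U₁ ∪ U₂) = U₁ := by
        ext x
        constructor
        · rintro ⟨hx, hx' | hx'⟩
          · exact hx'
          · exact hA₁ ⟨hx, hU₂ hx'⟩
        · exact fun hx => ⟨hU₁ hx, .inl hx⟩
      have e₂ : U' ∩ (U₁ ∪ U₂) = U₂ := by
        ext x
        constructor
        · rintro ⟨hx, hx' | hx'⟩
          · exact hA₂ ⟨hU₁ hx', hx⟩
          · exact hx'
        · exact fun hx => ⟨hU₂ hx, .inr hx⟩
      have hsubU : U₁ ∪ U₂ ⊆ U ∪ U' := Set.union_subset_union hU₁ hU₂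
      have hconv₁ : N.Convex U₁ (U₁ ∪ U₂) := by
        intro Y s p q hp hq hn
        have := hcU ((U₁ ∪ U₂) ∩ Y) s p q (hU₁ hp) (hU₁ hq)
          (by rwa [← Set.inter_assoc, Set.inter_eq_self_of_subset_right hsubU])
        rwa [← Set.inter_assoc, e₁] at this
      have hconv₂ : N.Convex U₂ (U₁ ∪ U₂) := by
        intro Y s p q hp hq hn
        have := hcU' ((U₁ ∪ U₂) ∩ Y) s p q (hU₂ hp) (hU₂ hq)
          (by rwa [← Set.inter_assoc, Set.inter_eq_self_of_subset_right hsubU])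
        rwa [← Set.inter_assoc, e₂] at this
      -- The set `Y` in the definition of `Convex` serves this purpose: convexity survives the
      -- deletion of parts.
      have restrict : ∀ {S W : Set P}, N.Convex S W → N.Convex (S \ N₀) (W \ N₀) := by
        intro S W h Y s p q hp hq hn
        rw [Set.sdiff_eq, Set.inter_assoc] at hn ⊢
        exact h _ s p q hp.1 hq.1 hn
      refine ⟨U₁ ∪ U₂, E₁ ∪ E₂, hX₁.trans Set.subset_union_left, hsubU, ?_, ?_, ?_, ?_, ?_⟩
      · intro Y s x y hx hy hn
        have hcross : ∀ {s x y}, N.part x ∈ U₁ → N.part y ∈ U₂ → N.Route ((U ∪ U') ∩ Y) s x y →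
            N.Route ((U₁ ∪ U₂) ∩ Y) s x y := by
          intro s x y hx hy hn
          have left : ∀ {s x y}, N.part x ∈ U₁ → N.part y ∈ U₁ → N.Route ((U ∪ U') ∩ Y) s x y →
              N.Route ((U₁ ∪ U₂) ∩ Y) s x y := fun hx hy hn =>
            N.route_mono (Set.inter_subset_inter_left _ Set.subset_union_left) le_rfl
              ((hc₁.trans hU₁ hcU) _ _ _ _ hx hy hn)
          have right : ∀ {s x y}, N.part x ∈ U₂ → N.part y ∈ U₂ →
              N.Route ((U ∪ U') ∩ Y) s x y → N.Route ((U₁ ∪ U₂) ∩ Y) s x y := fun hx hy hn =>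
            N.route_mono (Set.inter_subset_inter_left _ Set.subset_union_right) le_rfl
              ((hc₂.trans hU₂ hcU') _ _ _ _ hx hy hn)
          by_cases hxA : N.part x ∈ U ∩ U'
          · exact right (hA₂ hxA) hy hn
          -- Routes are split at vertices, not at centres, so that no length is lost and convexity
          -- stays exact.
          rcases N.route_split (U' := ((U ∪ U') ∩ Y) \ (U ∩ U')) ⟨N.route_mem hn, hxA⟩ hn with
            h | ⟨z, s₁, s₂, hz, h₁, h₂, hs⟩
          · exact absurd h (hsep _ _ _ _ (Set.sdiff_subset.trans Set.inter_subset_left)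
              Set.disjoint_sdiff_left (hU₁ hx) (hU₂ hy))
          · have hzA : N.part z ∈ U ∩ U' := by
              by_contra hcon
              exact hz.2 ⟨hz.1, hcon⟩
            exact N.route_mono subset_rfl hs
              (N.route_trans (left hx (hA₁ hzA) h₁) (right (hA₂ hzA) hy h₂))
        rcases hx with hx | hx <;> rcases hy with hy | hy
        · exact N.route_mono (Set.inter_subset_inter_left _ Set.subset_union_left) le_rfl
            ((hc₁.trans hU₁ hcU) _ _ _ _ hx hy hn)
        · exact hcross hx hy hn
        · exact N.route_symm (hcross hy hx (N.route_symm hn))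
        · exact N.route_mono (Set.inter_subset_inter_left _ Set.subset_union_right) le_rfl
            ((hc₂.trans hU₂ hcU') _ _ _ _ hx hy hn)
      · have hint' : (U₁ \ N₀) ∩ (U₂ \ N₀) = (U ∩ U') \ N₀ := by
          rw [← hint]; ext x; simp; tauto
        have hun : U₁ \ N₀ ∪ U₂ \ N₀ = (U₁ ∪ U₂) \ N₀ := by
          ext x; simp; tauto
        refine ⟨m₁ + m₂, ?_⟩
        rw [← hun]
        refine .glue hd₁ hd₂ ?_ ?_ ?_ (by rw [hun]; exact restrict hconv₁)
          (by rw [hun]; exact restrict hconv₂)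
        · rw [hint']
          exact fun x hx => ⟨⟨(hsub hx.1).1, hx.2⟩, ⟨(hsub hx.1).2, hx.2⟩⟩
        · rw [hint']
          obtain ⟨x, hx, hxN⟩ := Set.not_disjoint_iff.1 hN
          have : ((U ∩ U') \ N₀).ncard < (U ∩ U').ncard :=
            Set.ncard_lt_ncard ⟨Set.sdiff_subset, fun h => (h hx).2 hxN⟩ (Set.toFinite _)
          omega
        · intro Y s p q hY hd hp hq hn
          rw [hun] at hY
          refine hsep Y s p q (hY.trans (Set.sdiff_subset.trans hsubU)) ?_ (hU₁ hp.1) (hU₂ hq.1) hn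
          rw [hint'] at hd
          exact Set.disjoint_left.2 fun x hx hx' =>
            Set.disjoint_left.1 hd hx ⟨hx', (hY hx).2⟩
      · rintro p (hp | hp) hp'
        · obtain ⟨Y, hY, hpY⟩ := hcov₁ p hp fun h => hp' (.inl h)
          exact ⟨Y, .inl hY, hpY⟩
        · obtain ⟨Y, hY, hpY⟩ := hcov₂ p hp fun h => hp' (.inr h)
          exact ⟨Y, .inr hY, hpY⟩
      · rintro Y (hY | hY)
        · exact (hE₁ Y hY).extend (by omega) hA₁ (fun x hx => hA₁ ⟨hx.2, hU₂ hx.1⟩) hcU hsep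
        · have := (hE₂ Y hY).extend (U' := U) (V := U₁) (n' := m + n) (by omega)
            (by rwa [Set.inter_comm]) (fun x hx => hA₂ ⟨hU₁ hx.1, hx.2⟩)
            (by rwa [Set.union_comm]) hsep.symm
          rwa [Set.union_comm U', Set.union_comm U₂] at this
      · rintro Y (hY | hY) Y' (hY' | hY') hne
        · exact (hdis₁ Y hY Y' hY' hne).trans Set.subset_union_left
        · exact fun x hx => .inl (hA₁ ⟨(hE₁ _ hY).subset hx.1, (hE₂ _ hY').subset hx.2⟩)
        · exact fun x hx => .inl (hA₁ ⟨(hE₁ _ hY').subset hx.2, (hE₂ _ hY).subset hx.1⟩)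
        · exact (hdis₂ Y hY Y' hY' hne).trans Set.subset_union_right

end RouteSystem

/-! ### Shields, and colourings near the root bag. -/

namespace RouteSystem

variable {P : Type u} {ℓ : ℝ} {C : Type} {N : RouteSystem P ℓ} {good : Set P → Prop}

theorem Bdd.subset {U S S' : Set P} {s D : ℝ} {c : P → C} (hS : S' ⊆ S) (h : N.Bdd U S s c D) :
    N.Bdd U S' s c D := by
  intro p q hp hpq
  refine h p q (hS hp) (Relation.ReflTransGen.mono ?_ _ _ hpq)
  rintro a b ⟨ha, hb, hab⟩
  exact ⟨hS ha, hS hb, hab⟩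

theorem Bdd.of_near_imp {U U' S : Set P} {s D : ℝ} {c : P → C} (hU : U' ⊆ U)
    (h : N.Bdd U' S s c D) (hn : ∀ p ∈ S, ∀ q ∈ S, N.Near U s p q → N.Near U' s p q) :
    N.Bdd U S s c D := by
  intro p q hp hpq
  refine N.mono hU le_rfl (h p q hp (Relation.ReflTransGen.mono ?_ _ _ hpq))
  rintro a b ⟨ha, hb, hab, h⟩
  exact ⟨ha, hb, hab, hn a ha b hb h⟩

/-- A colouring `c` that agrees with `φ` on `A`, and in which the points near `A` have a colour of a
nearby point of `A` and are shielded from the rest by two layers of colours `κ₀` and `κ₁`. -/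
structure Shielded (N : RouteSystem P ℓ) (U A : Set P) (r : ℝ) (φ : P → C) (κ₀ κ₁ : C)
    (c : P → C) : Prop where
  eq : ∀ a ∈ A, c a = φ a
  core : ∀ p, ∀ a ∈ A, N.Near U (2 * r) a p → ∃ a' ∈ A, N.Near U (2 * r) a' p ∧ c p = φ a'
  inner : ∀ p, ∀ a ∈ A, N.Near U (4 * r) a p → (∀ a ∈ A, ¬ N.Near U (2 * r) a p) → c p = κ₀
  outer : ∀ p, ∀ a ∈ A, N.Near U (6 * r) a p → (∀ a ∈ A, ¬ N.Near U (4 * r) a p) → c p = κ₁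

/-- Only points within `6 * r` of `A` are recoloured. Elsewhere the old bound holds; the recoloured
points retract to at most `k` points, where every colouring is bounded. `Bdd.union` joins the two
regions. -/
theorem exists_shielded [Finite P] {U U₀ A : Set P} {k : ℕ} {r ρ D : ℝ} {c : P → C} (φ : P → C)
    (κ₀ κ₁ : C) (hU₀ : U₀ ⊆ U) (hA : A ⊆ U₀) (hk : A.ncard ≤ k) (hr : 0 < r) (hρ : 0 ≤ ρ)
    (hD : 0 ≤ D) (hc : N.Bdd U U₀ ρ c D) :
    ∃ c' : P → C, N.Shielded U A r φ κ₀ κ₁ c' ∧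
      N.Bdd U U₀ ρ c' (2 * (D + (k * (D + 2 * ρ + 2 * (6 * r)) + 2 * (6 * r)) + ρ)) := by
  classical
  let near (s : ℝ) (p : P) : Prop := ∃ a ∈ A, N.Near U s a p
  have hnear : ∀ {s s' : ℝ} {p : P}, s ≤ s' → near s p → near s' p :=
    fun hs ⟨a, ha, h⟩ => ⟨a, ha, Near.le N h hs⟩
  let c' (p : P) : C :=
    if p ∈ A then φ p else if h : near (2 * r) p then φ h.choose else
      if near (4 * r) p then κ₀ else if near (6 * r) p then κ₁ else c p
  have hself : ∀ {s : ℝ} {a : P}, 0 ≤ s → a ∈ A → near s a :=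
    fun hs ha => ⟨_, ha, N.refl (hU₀ (hA ha)) hs⟩
  refine ⟨c', ⟨fun a ha => if_pos ha, ?_, ?_, ?_⟩, ?_⟩
  · intro p a ha hn
    by_cases hp : p ∈ A
    · exact ⟨p, hp, N.refl (hU₀ (hA hp)) (by positivity), if_pos hp⟩
    · have h : near (2 * r) p := ⟨a, ha, hn⟩
      refine ⟨h.choose, h.choose_spec.1, h.choose_spec.2, ?_⟩
      simp only [c', if_neg hp, dif_pos h]
  · intro p a ha hn hn'
    have h2 : ¬ near (2 * r) p := fun ⟨a, ha, h⟩ => hn' a ha h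
    have hp : p ∉ A := fun hp => h2 (hself (by positivity) hp)
    simp only [c', if_neg hp, dif_neg h2, if_pos (show near (4 * r) p from ⟨a, ha, hn⟩)]
  · intro p a ha hn hn'
    have h4 : ¬ near (4 * r) p := fun ⟨a, ha, h⟩ => hn' a ha h
    have h2 : ¬ near (2 * r) p := fun h => h4 (hnear (by linarith) h)
    have hp : p ∉ A := fun hp => h2 (hself (by positivity) hp)
    simp only [c', if_neg hp, dif_neg h2, if_neg h4,
      if_pos (show near (6 * r) p from ⟨a, ha, hn⟩)]
  · have hsplit : U₀ = (U₀ \ {p | near (6 * r) p}) ∪ (U₀ ∩ {p | near (6 * r) p}) := by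
      rw [Set.union_comm, Set.inter_union_sdiff]
    rw [hsplit]
    have hfar : N.Bdd U (U₀ \ {p | near (6 * r) p}) ρ c' D := by
      refine Bdd.congr N (fun p hp => ?_) (hc.subset Set.sdiff_subset)
      have h6 : ¬ near (6 * r) p := hp.2
      have h4 : ¬ near (4 * r) p := fun h => h6 (hnear (by linarith) h)
      have h2 : ¬ near (2 * r) p := fun h => h4 (hnear (by linarith) h)
      have hpA : p ∉ A := fun hp => h2 (hself (by positivity) hp)
      simp only [c', if_neg hpA, dif_neg h2, if_neg h4, if_neg h6]
    refine Bdd.union N hρ hD (by positivity) hfar ?_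
    let h (p : P) : P := if h : near (6 * r) p then h.choose else p
    have hspec : ∀ p ∈ U₀ ∩ {p | near (6 * r) p}, h p ∈ A ∧ N.Near U (6 * r) (h p) p := by
      intro p hp
      have h6 : near (6 * r) p := hp.2
      simp only [h, dif_pos h6]
      exact h6.choose_spec
    exact Bdd.transport N (c' := fun _ => ()) h (fun p hp => (hspec p hp).1)
      (fun p hp => (hspec p hp).2) (fun _ _ _ _ _ => rfl)
      (bdd_of_ncard_le N (hA.trans hU₀) hk (by positivity))

/-- A step that leaves the `4 * r`-neighbourhood of `A` ends in the ring coloured `κ₁`. It would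
have to start at a point coloured `κ₀`, or within `2 * r` of `A`, which is too far away. So the
chain is shadowed by points of `A` with steps at most `4 * r + r + 4 * r`. -/
theorem Shielded.confined [Finite P] {U A : Set P} {k : ℕ} {r : ℝ} {φ : P → C} {κ₀ κ₁ : C}
    {c : P → C} (h : N.Shielded U A r φ κ₀ κ₁ c) (hκ : κ₀ ≠ κ₁) (hA : A ⊆ U) (hk : A.ncard ≤ k)
    (hr : 0 < r) {a p q : P} (ha : a ∈ A) (hap : N.Near U (2 * r) a p)
    (hpq : N.Conn U U r c p q) : N.Near U (6 * r + 9 * k * r) p q := by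
  have key : ∃ a' ∈ A, N.Conn U A (9 * r) (fun _ => ()) a a' ∧ N.Near U (4 * r) a' q ∧
      (c q = κ₀ ∨ N.Near U (2 * r) a' q) := by
    induction hpq with
    | refl => exact ⟨a, ha, .refl, Near.le N hap (by linarith), .inr hap⟩
    | @tail v w _ hvw ih =>
      obtain ⟨a', ha', haa', hav, hcol⟩ := ih
      have haw : N.Near U (5 * r) a' w := Near.le N (N.trans hav hvw.2.2.2) (by linarith)
      have step : ∀ b ∈ A, N.Near U (4 * r) b w → N.Conn U A (9 * r) (fun _ => ()) a b :=
        fun b hb hbw => haa'.tail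
          ⟨ha', hb, rfl, Near.le N (N.trans haw (N.symm hbw)) (by linarith)⟩
      by_cases h2 : ∃ b ∈ A, N.Near U (2 * r) b w
      · obtain ⟨b, hb, hbw⟩ := h2
        have hbw' : N.Near U (4 * r) b w := Near.le N hbw (by linarith)
        exact ⟨b, hb, step b hb hbw', hbw', .inr hbw⟩
      push Not at h2
      by_cases h4 : ∃ b ∈ A, N.Near U (4 * r) b w
      · obtain ⟨b, hb, hbw⟩ := h4
        exact ⟨b, hb, step b hb hbw, hbw, .inl (h.inner w b hb hbw h2)⟩
      exfalso
      push Not at h4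
      have hw : c w = κ₁ := h.outer w a' ha' (Near.le N haw (by linarith)) h4
      rcases hcol with hcol | hcol
      · exact hκ (hcol.symm.trans (hvw.2.2.1.trans hw))
      · exact h4 a' ha' (Near.le N (N.trans hcol hvw.2.2.2) (by linarith))
  obtain ⟨a', ha', haa', haq, -⟩ := key
  have := bdd_of_ncard_le N (c := fun _ => ()) hA hk (s := 9 * r) (by positivity) a a' ha haa'
  exact Near.le N (N.trans (N.trans (N.symm hap) this) haq) (by linarith)

/-- If a step of length `ρ` cannot be realised in `U₀ \ N₀`, it passes through `N₀`, so it starts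
within `R + ρ + ℓ ≤ R'` of `X`. Beyond `R'` the colouring `cb` serves; within `R'` points copy `ca`
from `X`. In the scale for `ca`, the term `Db + 2 * ρ` comes from `Bdd.union` and `2 * R'` from
`Bdd.transport`. -/
theorem exists_colouring_of_near_root {U U₀ X : Set P} {R R' ρ Db Da : ℝ} {cb ca : P → C}
    (hXU₀ : X ⊆ U₀) (hU₀ : U₀ ⊆ U) (hX : N.Convex X U) (hcU₀ : N.Convex U₀ U)
    (hR' : R + ρ + ℓ ≤ R') (hRn : 0 ≤ R) (hρ : 0 ≤ ρ) (hDb : 0 ≤ Db) (hDa : 0 ≤ Da)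
    (hb : N.Bdd (U₀ \ {p | ∃ x ∈ X, N.Near U R x p}) (U₀ \ {p | ∃ x ∈ X, N.Near U R x p}) ρ cb Db)
    (ha : N.Bdd X X (Db + 2 * ρ + 2 * R') ca Da) :
    ∃ c : P → C, N.Bdd U U₀ ρ c (2 * (Db + (Da + 2 * R') + ρ)) := by
  classical
  have hℓ := N.error_nonneg
  set N₀ := {p | ∃ x ∈ X, N.Near U R x p} with hN₀
  let near (p : P) : Prop := ∃ x ∈ X, N.Near U R' x p
  let h (p : P) : P := if h : near p then h.choose else p
  have hspec : ∀ p, near p → h p ∈ X ∧ N.Near U R' (h p) p := by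
    intro p hp
    simp only [h, dif_pos hp]
    exact hp.choose_spec
  refine ⟨fun p => if near p then ca (h p) else cb p, ?_⟩
  have hsplit : U₀ = (U₀ \ {p | near p}) ∪ (U₀ ∩ {p | near p}) := by
    rw [Set.union_comm, Set.inter_union_sdiff]
  rw [hsplit]
  refine Bdd.union N hρ hDb (by linarith) ?_ ?_
  · refine Bdd.congr N (c := cb) (fun p hp => (if_neg hp.2).symm) ?_
    have hsub : U₀ \ {p | near p} ⊆ U₀ \ N₀ := by
      rintro p ⟨hp, hp'⟩
      refine ⟨hp, fun ⟨x, hx, hn⟩ => hp' ⟨x, hx, Near.le N hn (by linarith)⟩⟩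
    refine (hb.subset hsub).of_near_imp (Set.sdiff_subset.trans hU₀) ?_
    intro p hp q hq hn
    rcases N.split (hsub hp) (hcU₀.near hp.1 hq.1 hn) with h1 | ⟨z, hz, hpz, -⟩
    · exact h1
    · exfalso
      have hzN : z ∈ N₀ := by
        by_contra hcon
        exact hz.2 ⟨hz.1, hcon⟩
      obtain ⟨x, hx, hxz⟩ := hzN
      exact hp.2 ⟨x, hx, Near.le N (N.trans hxz (N.symm (N.mono hU₀ le_rfl hpz))) (by linarith)⟩
  · refine Bdd.transport N (c' := ca) h (fun p hp => (hspec p hp.2).1)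
      (fun p hp => (hspec p hp.2).2) ?_ ?_
    · intro p hp q hq heq
      simpa only [if_pos (show near p from hp.2), if_pos (show near q from hq.2)] using heq
    · exact ha.of_near_imp (hXU₀.trans hU₀) fun p hp q hq hn => hX.near hp hq hn

theorem IsHanging.exists_near {k n : ℕ} {N₀ U U₀ Y : Set P} {s : ℝ} {p q : P}
    (h : IsHanging N good k n N₀ U U₀ Y) (hp : p ∉ Y \ U₀) (hq : q ∈ Y) (hn : N.Near U s p q) :
    ∃ z ∈ Y ∩ U₀, N.Near U (s + ℓ) p z ∧ N.Near U (s + ℓ) z q := by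
  have hs := N.nonneg hn
  have hℓ := N.error_nonneg
  by_cases hpA : p ∈ Y ∩ U₀
  · exact ⟨p, hpA, N.refl (N.mem hn) (by linarith), Near.le N hn (by linarith)⟩
  rcases N.split (U' := U \ (Y ∩ U₀)) ⟨N.mem hn, hpA⟩ hn with h1 | ⟨z, hz, hpz, hzq⟩
  · exact absurd h1 (h.separated _ s p q Set.sdiff_subset Set.disjoint_sdiff_left
      (fun hpY => hp ⟨hpY, fun hpU => hpA ⟨hpY, hpU⟩⟩) hq)
  · refine ⟨z, ?_, hpz, hzq⟩
    by_contra hcon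
    exact hz.2 ⟨hz.1, hcon⟩

end RouteSystem

/-! ### Attaching the hanging pieces, and the induction on the adhesion. -/

namespace RouteSystem

variable {P : Type u} {ℓ : ℝ} {C : Type} {N : RouteSystem P ℓ} {good : Set P → Prop}

/-- Colourings of the hanging sets that extend the colouring `c₀` of `U₀`, and whose monochromatic
components near `U₀` are small, combine with `c₀`. -/
theorem bdd_of_hanging {k n : ℕ} {N₀ U U₀ : Set P} {E : Set (Set P)} {r ρ σ D₁ D : ℝ} {c : P → C}
    (hr : 0 < r) (hℓr : ℓ ≤ r) (hσ : 2 * r ≤ σ) (hρ : σ + 3 * r ≤ ρ) (hDD : D₁ + 2 * σ ≤ D)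
    (hU₀ : U₀ ⊆ U) (hcov : ∀ p ∈ U, p ∉ U₀ → ∃ Y ∈ E, p ∈ Y)
    (hE : ∀ Y ∈ E, IsHanging N good k n N₀ U U₀ Y)
    (hdis : ∀ Y ∈ E, ∀ Y' ∈ E, Y ≠ Y' → Y ∩ Y' ⊆ U₀)
    (h₀ : N.Bdd U U₀ ρ c D₁) (hY : ∀ Y ∈ E, N.Bdd Y Y r c D)
    (hcore : ∀ Y ∈ E, ∀ p, ∀ a ∈ Y ∩ U₀, N.Near Y (2 * r) a p →
      ∃ a' ∈ Y ∩ U₀, N.Near Y (2 * r) a' p ∧ c p = c a')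
    (hconf : ∀ Y ∈ E, ∀ a ∈ Y ∩ U₀, ∀ p q, N.Near Y (2 * r) a p → N.Conn Y Y r c p q →
      N.Near Y (σ - 2 * r) p q) :
    N.Bdd U U r c D := by
  have henter : ∀ Y ∈ E, ∀ p q, p ∉ Y \ U₀ → q ∈ Y → N.Near U r p q →
      ∃ z ∈ Y ∩ U₀, N.Near U (2 * r) p z ∧ N.Near Y (2 * r) z q := by
    intro Y hYE p q hp hq hn
    obtain ⟨z, hz, hpz, hzq⟩ := (hE Y hYE).exists_near hp hq hn
    exact ⟨z, hz, Near.le N hpz (by linarith),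
      (hE Y hYE).convex.near hz.1 hq (Near.le N hzq (by linarith))⟩
  -- The anchor `u` of `v` is `v` itself, or a point within `2 * r` of a point `w` near the adhesion
  -- set of some `Y`, from which a monochromatic chain inside `Y` leads to `v`.
  let Anchored (u v : P) : Prop := u ∈ U₀ ∧ c u = c v ∧ (v = u ∨ ∃ Y ∈ E, v ∈ Y ∧
    ∃ a ∈ Y ∩ U₀, ∃ w ∈ Y, N.Near U (2 * r) u w ∧ N.Near Y (2 * r) a w ∧ N.Conn Y Y r c w v)
  have hanch : ∀ {u v}, Anchored u v → N.Near U σ u v := by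
    rintro u v ⟨hu, -, rfl | ⟨Y, hYE, hvY, a, ha, w, hw, huw, haw, hwv⟩⟩
    · exact N.refl (hU₀ hu) (by linarith)
    · exact Near.le N (N.trans huw (N.mono (hE Y hYE).subset le_rfl
        (hconf Y hYE a ha w v haw hwv))) (by linarith)
  have hnew : ∀ Y ∈ E, ∀ v, ∀ a ∈ Y ∩ U₀, N.Near Y (2 * r) a v →
      ∃ u, Anchored u v ∧ N.Near U (2 * r) u v := by
    intro Y hYE v a ha hav
    obtain ⟨u, hu, huv, hcol⟩ := hcore Y hYE v a ha hav
    have hvY := N.mem (N.symm hav)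
    have huv' := N.mono (hE Y hYE).subset le_rfl huv
    exact ⟨u, ⟨hu.2, hcol.symm, .inr ⟨Y, hYE, hvY, a, ha, v, hvY, huv', hav, .refl⟩⟩, huv'⟩
  -- Anchors move only when the chain steps into `U₀` or enters a hanging set, and then by at most
  -- `σ + r + 2 * r ≤ ρ`.
  have key : ∀ u v q, Anchored u v → N.Conn U U r c v q →
      ∃ u', Anchored u' q ∧ N.Conn U U₀ ρ c u u' := by
    intro u v q huv hvq
    induction hvq with
    | refl => exact ⟨u, huv, .refl⟩
    | @tail v w _ hvw ih =>
      obtain ⟨x, hxv, hux⟩ := ih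
      have hxw : N.Near U (σ + r) x w := N.trans (hanch hxv) hvw.2.2.2
      have hcol : c x = c w := hxv.2.1.trans hvw.2.2.1
      by_cases hw : w ∈ U₀
      · exact ⟨w, ⟨hw, rfl, .inl rfl⟩,
          hux.tail ⟨hxv.1, hw, hcol, Near.le N hxw (by linarith)⟩⟩
      obtain ⟨Y, hYE, hwY⟩ := hcov w hvw.2.1 hw
      by_cases hv : v ∈ Y \ U₀
      · rcases hxv.2.2 with rfl | ⟨Y', hYE', hvY', a, ha, y, hy, hxy, hay, hyv⟩
        · exact absurd hxv.1 hv.2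
        · have hYY : Y = Y' := by
            by_contra hne
            exact hv.2 (hdis Y hYE Y' hYE' hne ⟨hv.1, hvY'⟩)
          subst hYY
          exact ⟨x, ⟨hxv.1, hcol, .inr ⟨Y, hYE, hwY, a, ha, y, hy, hxy, hay,
            hyv.tail ⟨hvY', hwY, hvw.2.2.1, (hE Y hYE).convex.near hvY' hwY hvw.2.2.2⟩⟩⟩, hux⟩
      · obtain ⟨z, hz, -, hzw⟩ := henter Y hYE v w hv hwY hvw.2.2.2
        obtain ⟨u', hu', hu'w⟩ := hnew Y hYE w z hz hzw
        exact ⟨u', hu', hux.tail ⟨hxv.1, hu'.1, hcol.trans hu'.2.1.symm,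
          Near.le N (N.trans hxw (N.symm hu'w)) (by linarith)⟩⟩
  have hstart : ∀ p q, p ∈ U → N.Conn U U r c p q →
      (∃ Y ∈ E, p ∈ Y ∧ q ∈ Y ∧ N.Conn Y Y r c p q) ∨
        ∃ u v, Anchored u v ∧ N.Conn U U r c v p ∧ N.Conn U U r c v q := by
    intro p q hp hpq
    induction hpq with
    | refl =>
      by_cases hp₀ : p ∈ U₀
      · exact .inr ⟨p, p, ⟨hp₀, rfl, .inl rfl⟩, .refl, .refl⟩
      · obtain ⟨Y, hYE, hpY⟩ := hcov p hp hp₀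
        exact .inl ⟨Y, hYE, hpY, hpY, .refl⟩
    | @tail v w hv hvw ih =>
      rcases ih with ⟨Y, hYE, hpY, hvY, hpv⟩ | ⟨u, x, hux, hxp, hxv⟩
      · by_cases hwY : w ∈ Y
        · exact .inl ⟨Y, hYE, hpY, hwY,
            hpv.tail ⟨hvY, hwY, hvw.2.2.1, (hE Y hYE).convex.near hvY hwY hvw.2.2.2⟩⟩
        · obtain ⟨z, hz, -, hzv⟩ := henter Y hYE w v (fun h => hwY h.1) hvY (N.symm hvw.2.2.2)
          obtain ⟨u, hu, -⟩ := hnew Y hYE v z hz hzv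
          exact .inr ⟨u, v, hu, Conn.symm N hv, .single hvw⟩
      · exact .inr ⟨u, x, hux, hxp, hxv.tail hvw⟩
  intro p q hp hpq
  rcases hstart p q hp hpq with ⟨Y, hYE, hpY, hqY, h⟩ | ⟨u, v, huv, hvp, hvq⟩
  · exact N.mono (hE Y hYE).subset le_rfl (hY Y hYE p q hpY h)
  · obtain ⟨u₁, hu₁, h₁⟩ := key u v p huv hvp
    obtain ⟨u₂, hu₂, h₂⟩ := key u v q huv hvq
    have := h₀ u₁ u₂ hu₁.1 ((Conn.symm N h₁).trans h₂)
    exact Near.le N (N.trans (N.trans (N.symm (hanch hu₁)) this) (hanch hu₂)) (by linarith)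

/-- The bound for the colourings of a glued set at scale `r`, where `k` bounds the adhesion, `Db` is
the bound for smaller adhesion, and `Da` the bound for the bags. -/
noncomputable def stepBound (k : ℕ) (r Db Da : ℝ) : ℝ :=
  let ρ := 11 * r + 9 * k * r
  let D₀ := 2 * (Db + (Da + 2 * (8 * r + ρ)) + ρ)
  2 * (D₀ + (k * (D₀ + 2 * ρ + 2 * (6 * r)) + 2 * (6 * r)) + ρ) + 2 * (8 * r + 9 * k * r)

/-- The prescription `φ` and the shield are what makes the induction on the number of bags close:
each hanging `Y` is coloured with `c₀` prescribed on `Y ∩ U₀`, a set of at most `k` parts in its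
root bag. -/
theorem Glued.exists_extension [Finite P] {k : ℕ} {r Db Da : ℝ} {κ₀ κ₁ : C} (hκ : κ₀ ≠ κ₁)
    (hr : 0 < r) (hℓr : ℓ ≤ r) (hDb : 0 ≤ Db) (hDa : 0 ≤ Da)
    (hmono : ∀ X Y, good X → Y ⊆ X → good Y)
    (hb : ∀ m U X, N.Glued good k m U X → ∃ c : P → C, N.Bdd U U (11 * r + 9 * k * r) c Db)
    (ha : ∀ X, good X → ∃ c : P → C, N.Bdd X X
      (Db + 2 * (11 * r + 9 * k * r) + 2 * (8 * r + (11 * r + 9 * k * r))) c Da)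
    (n : ℕ) {U X : Set P} (hU : N.Glued good (k + 1) n U X) (A : Set P) (hA : A ⊆ X)
    (hAk : A.ncard ≤ k) (φ : P → C) :
    ∃ c : P → C, N.Bdd U U r c (stepBound k r Db Da) ∧ N.Shielded U A r φ κ₀ κ₁ c := by
  classical
  induction n using Nat.strong_induction_on generalizing U X A φ with
  | _ n ih =>
  -- This is `σ + 3 * r`, where `σ = 8 * r + 9 * k * r` is the bound of `Shielded.confined` plus `2
  -- * r`.
  obtain ⟨ρ, hρ⟩ : ∃ ρ, ρ = 11 * r + 9 * k * r := ⟨_, rfl⟩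
  have hkr : 0 ≤ 9 * (k : ℝ) * r := by positivity
  have hρ0 : 0 ≤ ρ := by rw [hρ]; positivity
  rw [← hρ] at hb ha
  -- The radius `7 * r` is the reach `6 * r` of the shield of `A` plus `ℓ ≤ r` for splitting a route
  -- at an adhesion set.
  obtain ⟨U₀, E, hXU₀, hU₀, hcU₀, ⟨m, hm⟩, hcov, hE, hdis⟩ :=
    hU.truncate hmono {p | ∃ x ∈ X, N.Near U (7 * r) x p}
  obtain ⟨cb, hcb⟩ := hb m _ _ hm
  obtain ⟨ca, hca⟩ := ha X hU.good_root
  obtain ⟨c₁, hc₁⟩ := exists_colouring_of_near_root hXU₀ hU₀ hU.convex_root hcU₀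
    (R' := 8 * r + ρ) (by linarith) (by positivity) hρ0 hDb hDa hcb hca
  obtain ⟨c₀, hc₀, hbd₀⟩ := exists_shielded φ κ₀ κ₁ hU₀ (hA.trans hXU₀) hAk hr hρ0
    (by positivity) hc₁
  have hext : ∀ Y ∈ E, ∃ c : P → C, N.Bdd Y Y r c (stepBound k r Db Da) ∧
      N.Shielded Y (Y ∩ U₀) r c₀ κ₀ κ₁ c := by
    intro Y hY
    obtain ⟨m, hm, X', hX', hsub⟩ := (hE Y hY).glued
    exact ih m hm hX' _ hsub (Nat.lt_succ_iff.1 (hE Y hY).ncard_lt) c₀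
  have : Nonempty C := ⟨κ₀⟩
  choose! cY hYbd hYsh using hext
  let c (p : P) : C := if p ∈ U₀ then c₀ p else if h : ∃ Y ∈ E, p ∈ Y then cY h.choose p else c₀ p
  have hcU : ∀ p ∈ U₀, c p = c₀ p := fun p hp => if_pos hp
  have hcY : ∀ Y ∈ E, ∀ p ∈ Y, cY Y p = c p := by
    intro Y hY p hp
    by_cases hp₀ : p ∈ U₀
    · rw [hcU p hp₀, (hYsh Y hY).eq p ⟨hp, hp₀⟩]
    · have h : ∃ Y ∈ E, p ∈ Y := ⟨Y, hY, hp⟩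
      have heq : h.choose = Y := by
        by_contra hne
        exact hp₀ (hdis _ h.choose_spec.1 Y hY hne ⟨h.choose_spec.2, hp⟩)
      simp only [c, if_neg hp₀, dif_pos h, heq]
  -- The shield of `A` lies inside `U₀`, so the colourings of the hanging sets do not disturb it.
  have hnear : ∀ p, ∀ a ∈ A, N.Near U (6 * r) a p → p ∈ U₀ := by
    intro p a ha hn
    by_contra hp
    obtain ⟨Y, hY, hpY⟩ := hcov p (N.mem (N.symm hn)) hp
    obtain ⟨z, hz, haz, -⟩ := (hE Y hY).exists_near (fun h => h.2 (hXU₀ (hA ha))) hpY hn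
    exact Set.disjoint_left.1 (hE Y hY).disjoint hz
      ⟨a, hA ha, Near.le N haz (by linarith)⟩
  refine ⟨c, ?_, ?_⟩
  · have hshield : ∀ Y ∈ E, ∀ a ∈ Y ∩ U₀, ∀ p q, N.Near Y (2 * r) a p → N.Conn Y Y r c p q →
        N.Near Y (6 * r + 9 * k * r) p q := by
      intro Y hY a ha p q hap hpq
      refine (hYsh Y hY).confined hκ Set.inter_subset_left
        (Nat.lt_succ_iff.1 (hE Y hY).ncard_lt) hr ha hap (Relation.ReflTransGen.mono ?_ _ _ hpq)
      rintro x y ⟨hx, hy, hxy, h⟩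
      exact ⟨hx, hy, by rw [hcY Y hY x hx, hcY Y hY y hy, hxy], h⟩
    refine bdd_of_hanging (σ := 8 * r + 9 * k * r) (ρ := ρ) hr hℓr (by linarith) (by linarith)
      (by rw [stepBound, ← hρ]) hU₀ hcov hE hdis
      (Bdd.congr N (fun p hp => (hcU p hp).symm) hbd₀)
      (fun Y hY => Bdd.congr N (hcY Y hY) (hYbd Y hY)) ?_ ?_
    · intro Y hY p a ha hn
      obtain ⟨a', ha', hn', hcol⟩ := (hYsh Y hY).core p a ha hn
      exact ⟨a', ha', hn', by rw [← hcY Y hY p (N.mem (N.symm hn)), hcol, hcU a' ha'.2]⟩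
    · intro Y hY a ha p q hn hpq
      exact Near.le N (hshield Y hY a ha p q hn hpq) (by linarith)
  · refine ⟨fun a ha => ?_, fun p a ha hn => ?_, fun p a ha hn hn' => ?_,
      fun p a ha hn hn' => ?_⟩
    · rw [hcU a (hXU₀ (hA ha)), hc₀.eq a ha]
    · rw [hcU p (hnear p a ha (Near.le N hn (by linarith)))]
      exact hc₀.core p a ha hn
    · rw [hcU p (hnear p a ha (Near.le N hn (by linarith)))]
      exact hc₀.inner p a ha hn hn'
    · rw [hcU p (hnear p a ha hn)]
      exact hc₀.outer p a ha hn hn'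

/-- The bound for the colourings at scale `r` of sets glued along fewer than `k` elements, if `g` is
the bound for the bags. -/
noncomputable def gluedBound (g : ℝ → ℝ) : ℕ → ℝ → ℝ
  | 0, r => g r
  | k + 1, r =>
    let ρ := 11 * r + 9 * k * r
    let Db := gluedBound g k ρ
    stepBound k r Db (g (Db + 2 * ρ + 2 * (8 * r + ρ)))

theorem stepBound_pos {k : ℕ} {r Db Da : ℝ} (hr : 0 < r) (hDb : 0 < Db) (hDa : 0 < Da) :
    0 < stepBound k r Db Da := by
  unfold stepBound
  positivity

theorem gluedBound_pos {g : ℝ → ℝ} (hg : ∀ s, 0 < s → 0 < g s) (k : ℕ) {r : ℝ} (hr : 0 < r) :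
    0 < gluedBound g k r := by
  induction k generalizing r with
  | zero => exact hg r hr
  | succ k ih =>
    have := ih (r := 11 * r + 9 * k * r) (by positivity)
    exact stepBound_pos hr this (hg _ (by positivity))

/-- `stepBound` is increasing in `Db` and `Da` and homogeneous of degree one in all lengths, so
linear bounds stay linear and its value at `r = 1` is the new slope. -/
theorem gluedBound_le {g : ℝ → ℝ} (hg : ∀ s, 0 < s → 0 < g s) {b : ℝ} (hb : 0 < b)
    (hgb : ∀ s, 0 < s → g s ≤ b * s) (k : ℕ) :
    ∃ b' : ℝ, 0 < b' ∧ ∀ r, 0 < r → gluedBound g k r ≤ b' * r := by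
  induction k with
  | zero => exact ⟨b, hb, hgb⟩
  | succ k ih =>
    obtain ⟨d, hd, hdb⟩ := ih
    obtain ⟨e, he⟩ : ∃ e : ℝ, e = 11 + 9 * k := ⟨_, rfl⟩
    have he0 : 0 < e := by rw [he]; positivity
    refine ⟨stepBound k 1 (d * e) (b * (d * e + 2 * e + 2 * (8 + e))),
      stepBound_pos one_pos (by positivity) (by positivity), fun r hr => ?_⟩
    have h1 : 11 * r + 9 * k * r = e * r := by rw [he]; ring
    have h2 := hdb (e * r) (by positivity)
    have h2' := gluedBound_pos hg k (r := e * r) (by positivity)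
    have h3 := hgb (gluedBound g k (e * r) + 2 * (e * r) + 2 * (8 * r + e * r)) (by positivity)
    have h4 : b * (gluedBound g k (e * r) + 2 * (e * r) + 2 * (8 * r + e * r)) ≤
        b * (d * e + 2 * e + 2 * (8 + e)) * r := by
      rw [mul_assoc]
      refine mul_le_mul_of_nonneg_left ?_ hb.le
      linarith
    simp only [gluedBound, h1]
    have h5 : stepBound k r (d * e * r) (b * (d * e + 2 * e + 2 * (8 + e)) * r) =
        stepBound k 1 (d * e) (b * (d * e + 2 * e + 2 * (8 + e))) * r := by
      unfold stepBound
      ring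
    rw [← h5]
    have h6 : gluedBound g k (e * r) ≤ d * e * r := by linarith
    have h7 := h3.trans h4
    simp only [stepBound]
    gcongr

/-- Induction on the adhesion bound, with nothing prescribed (`A = ∅`). At `k = 0` no gluing is
possible, since an adhesion set would have fewer than zero elements. -/
theorem Glued.exists_bdd [Finite P] {κ₀ κ₁ : C} (hκ : κ₀ ≠ κ₁) {g : ℝ → ℝ}
    (hg : ∀ s, 0 < s → 0 < g s) (k : ℕ) {n : ℕ} {U X : Set P} {r : ℝ} (hr : 0 < r) (hℓr : ℓ ≤ r)
    (hU : N.Glued (fun X => ∀ Y ⊆ X, ∀ s, 0 < s → ℓ ≤ s → ∃ c : P → C, N.Bdd Y Y s c (g s)) k n U X) :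
    ∃ c : P → C, N.Bdd U U r c (gluedBound g k r) := by
  induction k generalizing n U X r with
  | zero =>
    cases hU with
    | bag h => exact h _ subset_rfl r hr hℓr
    | glue _ _ _ h => exact absurd h (Nat.not_lt_zero _)
  | succ k ih =>
    have hkr : 0 ≤ 9 * (k : ℝ) * r := by positivity
    have hDb := gluedBound_pos hg k (r := 11 * r + 9 * k * r) (by positivity)
    have hDa := hg (gluedBound g k (11 * r + 9 * k * r) + 2 * (11 * r + 9 * k * r) +
      2 * (8 * r + (11 * r + 9 * k * r))) (by positivity)
    obtain ⟨c, hc, -⟩ := hU.exists_extension hκ hr hℓr hDb.le hDa.le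
      (fun X Y hX hYX Z hZ => hX Z (hZ.trans hYX))
      (fun m U X h => ih (by positivity) (by linarith) h)
      (fun X hX => hX X subset_rfl _ (by positivity) (by linarith))
      n ∅ (Set.empty_subset _) (by simp) (fun _ => κ₀)
    exact ⟨c, hc⟩

end RouteSystem

/-! ### Chains for a length function, and the route systems they define. -/

/-- `x` and `y` are joined by a chain inside `W` of total length at most `L`, where the steps have
finite length with respect to `w`. -/
inductive Reach {V : Type u} (w : V → V → ℝ≥0∞) (W : Set V) : ℝ≥0∞ → V → V → Prop
  | nil {x : V} {L : ℝ≥0∞} : x ∈ W → Reach w W L x x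
  | cons {x y z : V} {L L' : ℝ≥0∞} : x ∈ W → w x y ≠ ⊤ → Reach w W L y z → w x y + L ≤ L' →
      Reach w W L' x z

namespace Reach

variable {V : Type u} {w : V → V → ℝ≥0∞} {W W' : Set V} {L L' : ℝ≥0∞} {x y z : V}

theorem left_mem (h : Reach w W L x y) : x ∈ W := by
  cases h <;> assumption

theorem mono (hW : W ⊆ W') (hL : L ≤ L') (h : Reach w W L x y) : Reach w W' L' x y := by
  induction h generalizing L' with
  | nil hx => exact .nil (hW hx)
  | cons hx hw _ hle ih => exact .cons (hW hx) hw (ih le_rfl) (hle.trans hL)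

theorem trans (h : Reach w W L x y) (h' : Reach w W L' y z) : Reach w W (L + L') x z := by
  induction h with
  | nil hx => exact h'.mono subset_rfl le_add_self
  | cons hx hw _ hle ih =>
    exact .cons hx hw (ih h') (by rw [← add_assoc]; exact add_le_add_left hle _)

theorem single (hx : x ∈ W) (hy : y ∈ W) (hw : w x y ≠ ⊤) : Reach w W (w x y) x y :=
  .cons hx hw (.nil (L := 0) hy) (by simp)

theorem symm (hw : ∀ x y, w x y = w y x) (h : Reach w W L x y) : Reach w W L y x := by
  induction h with
  | nil hx => exact .nil hx
  | @cons x y z L L' hx hxy hyz hle ih =>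
    refine (ih.trans (single hyz.left_mem hx (by rwa [hw]))).mono subset_rfl ?_
    rwa [hw y x, add_comm]

theorem split (hx : x ∈ W') (h : Reach w W L x y) :
    Reach w W' L x y ∨ ∃ z ∈ W \ W', ∃ L₁ L₂, Reach w W L₁ x z ∧ Reach w W L₂ z y ∧
      L₁ + L₂ ≤ L := by
  induction h with
  | nil => exact .inl (.nil hx)
  | @cons x y z L L' hxW hxy hyz hle ih =>
    by_cases hy : y ∈ W'
    · rcases ih hy with h | ⟨v, hv, L₁, L₂, h₁, h₂, hL⟩
      · exact .inl (.cons hx hxy h hle)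
      · exact .inr ⟨v, hv, w x y + L₁, L₂, .cons hxW hxy h₁ le_rfl, h₂,
          by rw [add_assoc]; exact (add_le_add_right hL _).trans hle⟩
    · exact .inr ⟨y, ⟨hyz.left_mem, hy⟩, w x y, L, single hxW hyz.left_mem hxy, hyz, hle⟩

/-- Serves to compare chains with distances, both in `G` and in an induced subgraph of a torso; `e`
is the passage to its vertices. -/
theorem le_of_triangle {V' : Type u} {δ : V' → V' → ℝ≥0∞} (e : W → V') (h₀ : ∀ x, δ x x = 0)
    (htri : ∀ x y z, δ x z ≤ δ x y + δ y z)
    (hδ : ∀ x y : W, w x y ≠ ⊤ → δ (e x) (e y) ≤ w x y)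
    (h : Reach w W L x y) (hx : x ∈ W) (hy : y ∈ W) : δ (e ⟨x, hx⟩) (e ⟨y, hy⟩) ≤ L := by
  induction h with
  | nil => rw [h₀]; exact zero_le
  | cons _ hw hyz hle ih =>
    exact (htri _ _ _).trans
      ((add_le_add (hδ ⟨_, hx⟩ ⟨_, hyz.left_mem⟩ hw) (ih hyz.left_mem hy)).trans hle)

/-- A chain in `M ∪ M'` meets `M ∩ M'` if it joins `M` to `M'` and no step crosses. -/
theorem not_of_disjoint {M M' : Set V} (hcross : ∀ x ∈ M \ M', ∀ y ∈ M' \ M, w x y = ⊤)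
    (hW : W ⊆ M ∪ M') (hd : Disjoint W (M ∩ M')) (hx : x ∈ M) (hy : y ∈ M') :
    ¬ Reach w W L x y := by
  intro h
  induction h with
  | nil h => exact Set.disjoint_left.1 hd h ⟨hx, hy⟩
  | cons hxW hw hyz _ ih =>
    refine ih ?_ hy
    by_contra hy'
    exact hw (hcross _ ⟨hx, fun hx' => Set.disjoint_left.1 hd hxW ⟨hx, hx'⟩⟩ _
      ⟨(hW hyz.left_mem).resolve_left hy', hy'⟩)

/-- Excursions of a chain across a separator whose pairs have minimal length can be cut off. -/
theorem shortcut {M M' Y : Set V} {δ : V → V → ℝ≥0∞}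
    (hcross : ∀ x ∈ M \ M', ∀ y ∈ M' \ M, w x y = ⊤) (hsymm : ∀ x y, w x y = w y x)
    (htri : ∀ x y z, δ x z ≤ δ x y + δ y z) (hδ : ∀ x y, δ x y ≤ w x y)
    (hcl : ∀ x ∈ M ∩ M', ∀ y ∈ M ∩ M', x ≠ y → w x y ≤ δ x y)
    (hL : L ≠ ⊤) (hx : x ∈ M) (hy : y ∈ M) (h : Reach w ((M ∪ M') ∩ Y) L x y) :
    Reach w (M ∩ Y) L x y := by
  -- A chain that starts outside `M` is cut at its first point `a` in `M`, which lies in `M ∩ M'`;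
  -- only a bound on `δ x a` is kept from the initial piece.
  have key : (x ∈ M → Reach w (M ∩ Y) L x y) ∧ (x ∉ M → ∃ a ∈ M ∩ M' ∩ Y, ∃ L₁ L₂,
      δ x a ≤ L₁ ∧ Reach w (M ∩ Y) L₂ a y ∧ L₁ + L₂ ≤ L) := by
    clear hx
    induction h with
    | nil h => exact ⟨fun hx => .nil ⟨hx, h.2⟩, fun hx => absurd hy hx⟩
    | @cons x v y L L' hxW hxv hvy hle ih =>
      have hL'' : L ≠ ⊤ := fun h => hL (by simpa [h] using hle)
      obtain ⟨ih₁, ih₂⟩ := ih hL'' hy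
      by_cases hv : v ∈ M
      · refine ⟨fun hx => .cons ⟨hx, hxW.2⟩ hxv (ih₁ hv) hle, fun hx => ?_⟩
        have hxM' := hxW.1.resolve_left hx
        have hvM' : v ∈ M' := by
          by_contra hvM'
          exact hxv (by rw [hsymm]; exact hcross v ⟨hv, hvM'⟩ x ⟨hxM', hx⟩)
        exact ⟨v, ⟨⟨hv, hvM'⟩, hvy.left_mem.2⟩, w x v, L, hδ x v, ih₁ hv, hle⟩
      · have hvM' := hvy.left_mem.1.resolve_left hv
        obtain ⟨a, ha, L₁, L₂, h₁, h₂, h₁₂⟩ := ih₂ hv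
        have hxa : δ x a ≤ w x v + L₁ := (htri x v a).trans (add_le_add (hδ x v) h₁)
        have hle' : w x v + L₁ + L₂ ≤ L' := by
          rw [add_assoc]; exact (add_le_add_right h₁₂ _).trans hle
        refine ⟨fun hx => ?_, fun _ => ⟨a, ha, _, L₂, hxa, h₂, hle'⟩⟩
        have hxM' : x ∈ M' := by
          by_contra hxM'
          exact hxv (hcross x ⟨hx, hxM'⟩ v ⟨hvM', hv⟩)
        -- `hcl` says nothing about `w x x`; an excursion that returns to its start is simply
        -- dropped.
        by_cases hne : x = a
        · subst hne
          exact h₂.mono subset_rfl (le_add_self.trans hle')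
        · have hwa := (hcl x ⟨hx, hxM'⟩ a ha.1 hne).trans hxa
          refine .cons ⟨hx, hxW.2⟩ ?_ h₂ ((add_le_add_left hwa _).trans hle')
          exact ne_top_of_le_ne_top hL (hwa.trans (le_self_add.trans hle'))
  exact key.1 hx

end Reach

namespace RouteSystem

variable {V P ι : Type u} {ℓ : ℝ}

/-- The routes given by chains with respect to a symmetric length function. -/
def ofWeight (w : V → V → ℝ≥0∞) (hw : ∀ x y, w x y = w y x) (part : V → P) (centre : P → V)
    (hpc : ∀ p, part (centre p) = p) (hℓ : 0 ≤ ℓ)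
    (hc : ∀ x, Reach w (part ⁻¹' {part x}) (ENNReal.ofReal ℓ) x (centre (part x))) :
    RouteSystem P ℓ where
  V := V
  part := part
  centre := centre
  part_centre := hpc
  error_nonneg := hℓ
  Route U s x y := 0 ≤ s ∧ Reach w (part ⁻¹' U) (ENNReal.ofReal s) x y
  route_refl hx hs := ⟨hs, .nil hx⟩
  route_symm h := ⟨h.1, h.2.symm hw⟩
  route_trans h h' :=
    ⟨add_nonneg h.1 h'.1, by rw [ENNReal.ofReal_add h.1 h'.1]; exact h.2.trans h'.2⟩
  route_mono hU hs h :=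
    ⟨h.1.trans hs, h.2.mono (Set.preimage_mono hU) (ENNReal.ofReal_le_ofReal hs)⟩
  route_nonneg h := h.1
  route_mem h := h.2.left_mem
  route_centre x := ⟨hℓ, hc x⟩
  route_split := by
    rintro U U' s x y hx ⟨hs, h⟩
    rcases h.split (W' := part ⁻¹' U') hx with h | ⟨z, hz, L₁, L₂, h₁, h₂, hL⟩
    · exact .inl ⟨hs, h⟩
    · have hsum : L₁ + L₂ ≠ ⊤ := ne_top_of_le_ne_top ENNReal.ofReal_ne_top hL
      have hL₁ : L₁ ≠ ⊤ := ne_top_of_le_ne_top hsum le_self_add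
      have hL₂ : L₂ ≠ ⊤ := ne_top_of_le_ne_top hsum le_add_self
      refine .inr ⟨z, L₁.toReal, L₂.toReal, hz, ⟨ENNReal.toReal_nonneg, ?_⟩,
        ⟨ENNReal.toReal_nonneg, ?_⟩, ?_⟩
      · rwa [ENNReal.ofReal_toReal hL₁]
      · rwa [ENNReal.ofReal_toReal hL₂]
      · rw [← ENNReal.toReal_add hL₁ hL₂]
        exact ENNReal.toReal_le_of_le_ofReal hs hL

section

variable {w : V → V → ℝ≥0∞} {hw : ∀ x y, w x y = w y x} {part : V → P} {centre : P → V}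
  {hpc : ∀ p, part (centre p) = p} {hℓ : 0 ≤ ℓ}
  {hc : ∀ x, Reach w (part ⁻¹' {part x}) (ENNReal.ofReal ℓ) x (centre (part x))}

theorem separated_ofWeight {U U' : Set P}
    (hcross : ∀ x y, part x ∈ U \ U' → part y ∈ U' \ U → w x y = ⊤) :
    (ofWeight w hw part centre hpc hℓ hc).Separated U U' := by
  rintro Y s x y hY hd hx hy ⟨-, h⟩
  exact Reach.not_of_disjoint (M := part ⁻¹' U) (M' := part ⁻¹' U') (W := part ⁻¹' Y)
    (fun x hx y hy => hcross x y hx hy) (Set.preimage_mono hY) (hd.preimage part) hx hy h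

theorem convex_ofWeight {U U' : Set P} {δ : V → V → ℝ≥0∞}
    (hcross : ∀ x y, part x ∈ U \ U' → part y ∈ U' \ U → w x y = ⊤)
    (htri : ∀ x y z, δ x z ≤ δ x y + δ y z) (hδ : ∀ x y, δ x y ≤ w x y)
    (hcl : ∀ x y, part x ∈ U ∩ U' → part y ∈ U ∩ U' → x ≠ y → w x y ≤ δ x y) :
    (ofWeight w hw part centre hpc hℓ hc).Convex U (U ∪ U') := by
  rintro Y s x y hx hy ⟨hs, h⟩
  exact ⟨hs, Reach.shortcut (M := part ⁻¹' U) (M' := part ⁻¹' U') (Y := part ⁻¹' Y)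
    (fun x hx y hy => hcross x y hx hy) hw htri hδ (fun x hx y hy => hcl x y hx hy)
    ENNReal.ofReal_ne_top hx hy h⟩

end

end RouteSystem

/-! ### The two sides of a tree edge. -/

namespace SimpleGraph

variable {ι : Type u} {T : SimpleGraph ι} {t t' : ι}

/-- The vertices joined to `t` in the graph without the edge `tt'`. -/
def side (T : SimpleGraph ι) (t t' : ι) : Set ι :=
  {a | (T.deleteEdges {s(t, t')}).Reachable t a}

theorem mem_side_self : t ∈ T.side t t' := .refl _

theorem mem_side_or (hT : T.Connected) (t t' a : ι) : a ∈ T.side t t' ∨ a ∈ T.side t' t := by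
  have h := (T.reachable_iff_reflTransGen t a).1 (hT t a)
  induction h with
  | refl => exact .inl mem_side_self
  | @tail a b _ hab ih =>
    by_cases he : s(a, b) = s(t, t')
    · rcases Sym2.eq_iff.1 he with ⟨-, rfl⟩ | ⟨-, rfl⟩
      · exact .inr mem_side_self
      · exact .inl mem_side_self
    · have h₁ : (T.deleteEdges {s(t, t')}).Adj a b := by
        rw [deleteEdges_adj]; exact ⟨hab, he⟩
      have h₂ : (T.deleteEdges {s(t', t)}).Adj a b := by
        rw [Sym2.eq_swap]; exact h₁
      exact ih.imp (fun h => h.trans h₁.reachable) (fun h => h.trans h₂.reachable)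

theorem disjoint_side (hT : T.IsAcyclic) (h : T.Adj t t') :
    Disjoint (T.side t t') (T.side t' t) := by
  have hb := isAcyclic_iff_forall_adj_isBridge.1 hT h
  rw [isBridge_iff] at hb
  refine Set.disjoint_left.2 fun a ha ha' => hb ?_
  have ha'' : (T.deleteEdges {s(t, t')}).Reachable t' a := by
    rw [Sym2.eq_swap]; exact ha'
  exact ha.trans ha''.symm

theorem eq_of_adj_side (hT : T.IsAcyclic) (h : T.Adj t t') {a b : ι} (hab : T.Adj a b)
    (ha : a ∈ T.side t t') (hb : b ∈ T.side t' t) : a = t ∧ b = t' := by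
  have hd := Set.disjoint_left.1 (disjoint_side hT h)
  by_cases he : s(a, b) = s(t, t')
  · rcases Sym2.eq_iff.1 he with h | ⟨rfl, rfl⟩
    · exact h
    · exact absurd mem_side_self (hd ha)
  · have h₁ : (T.deleteEdges {s(t, t')}).Adj a b := by
      rw [deleteEdges_adj]; exact ⟨hab, he⟩
    exact absurd hb (hd (ha.trans h₁.reachable))

/-- Any two elements of `S` are joined inside `S`. -/
def ConnectedOn (T : SimpleGraph ι) (S : Set ι) : Prop :=
  ∀ a ∈ S, ∀ b ∈ S, Relation.ReflTransGen (fun x y => T.Adj x y ∧ x ∈ S ∧ y ∈ S) a b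

theorem connectedOn_of_induce {S : Set ι} (h : (T.induce S).Connected) : T.ConnectedOn S := by
  intro a ha b hb
  have := ((T.induce S).reachable_iff_reflTransGen ⟨a, ha⟩ ⟨b, hb⟩).1 (h _ _)
  exact Relation.ReflTransGen.lift Subtype.val
    (fun x y hxy => ⟨hxy, x.2, y.2⟩) _ _ this

/-- The edge `tt'` is the only edge between the two sides, so a walk in `S` from one to the other
uses it. -/
theorem ConnectedOn.mem_ends {S : Set ι} (hS : T.ConnectedOn S) (hT : T.IsTree)
    (h : T.Adj t t') {a b : ι} (ha : a ∈ S) (hb : b ∈ S) (ha' : a ∈ T.side t t')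
    (hb' : b ∈ T.side t' t) : t ∈ S ∧ t' ∈ S := by
  have hr := hS a ha b hb
  clear ha
  induction hr using Relation.ReflTransGen.head_induction_on with
  | refl => exact absurd hb' (Set.disjoint_left.1 (disjoint_side hT.isAcyclic h) ha')
  | @head a c hac _ ih =>
    rcases mem_side_or hT.connected t t' c with hc | hc
    · exact ih hc
    · obtain ⟨rfl, rfl⟩ := eq_of_adj_side hT.isAcyclic h hac.1 ha' hc
      exact hac.2

theorem ConnectedOn.inter_side {S : Set ι} (hS : T.ConnectedOn S) (hT : T.IsTree)
    (h : T.Adj t t') (ht : t ∈ S) : T.ConnectedOn (S ∩ T.side t t') := by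
  have hd := Set.disjoint_left.1 (disjoint_side hT.isAcyclic h)
  have key : ∀ b ∈ S, b ∈ T.side t t' → Relation.ReflTransGen
      (fun x y => T.Adj x y ∧ x ∈ S ∩ T.side t t' ∧ y ∈ S ∩ T.side t t') t b := by
    intro b hb hb'
    have hr := hS t ht b hb
    clear hb
    induction hr with
    | refl => exact .refl
    | @tail a b _ hab ih =>
      rcases mem_side_or hT.connected t t' a with ha | ha
      · exact (ih ha).tail ⟨hab.1, ⟨hab.2.1, ha⟩, ⟨hab.2.2, hb'⟩⟩
      · obtain ⟨rfl, rfl⟩ := eq_of_adj_side hT.isAcyclic h hab.1.symm hb' ha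
        exact .refl
  intro a ha b hb
  refine Relation.ReflTransGen.trans ?_ (key b hb.1 hb.2)
  have hta := key a ha.1 ha.2
  clear ha
  induction hta with
  | refl => exact .refl
  | tail _ hxy ih => exact .head ⟨hxy.1.symm, hxy.2.2, hxy.2.1⟩ ih

theorem exists_adj_mem_side (hT : T.Connected) {a : ι} (ha : t ≠ a) :
    ∃ t', T.Adj t t' ∧ a ∈ T.side t' t := by
  classical
  obtain ⟨p⟩ := hT t a
  have hp := p.bypass_isPath
  cases hq : p.bypass with
  | nil => exact absurd rfl ha
  | @cons _ t' _ h q =>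
    rw [hq, Walk.cons_isPath_iff] at hp
    refine ⟨t', h, ⟨q.toDeleteEdges {s(t', t)} ?_⟩⟩
    rintro e he rfl
    exact hp.2 (q.snd_mem_support_of_mem_edges he)

end SimpleGraph

/-! ### From tree-decompositions to gluings. -/

namespace RouteSystem

variable {V P ι : Type u} {ℓ : ℝ}
  {w : V → V → ℝ≥0∞} {hw : ∀ x y, w x y = w y x} {part : V → P} {centre : P → V}
  {hpc : ∀ p, part (centre p) = p} {hℓ : 0 ≤ ℓ}
  {hc : ∀ x, Reach w (part ⁻¹' {part x}) (ENNReal.ofReal ℓ) x (centre (part x))}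

/-- Split the subtree `S` at an edge `tt'` at its root. Parts in bags of both sides lie in `B t ∩ B
t'`. No finite step crosses, since its ends share a bag. By `hcl`, pairs in the adhesion set are
joined by steps of minimal length, which gives convexity. -/
theorem exists_glued_of_tree [Finite ι] [Finite P] {T : SimpleGraph ι} {B : ι → Set P} {k : ℕ}
    {good : Set P → Prop} {δ : V → V → ℝ≥0∞} (hT : T.IsTree)
    (hB : ∀ p, T.ConnectedOn {t | p ∈ B t})
    (hedge : ∀ x y, w x y ≠ ⊤ → ∃ t, part x ∈ B t ∧ part y ∈ B t)
    (htri : ∀ x y z, δ x z ≤ δ x y + δ y z) (hδ : ∀ x y, δ x y ≤ w x y)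
    (hcl : ∀ t t', T.Adj t t' → ∀ x y, part x ∈ B t ∩ B t' → part y ∈ B t ∩ B t' → x ≠ y →
      w x y ≤ δ x y)
    (hk : ∀ t t', T.Adj t t' → (B t ∩ B t').ncard < k) (hgood : ∀ t, good (B t))
    {S : Set ι} (hS : T.ConnectedOn S) {t : ι} (ht : t ∈ S) :
    ∃ n, (ofWeight w hw part centre hpc hℓ hc).Glued good k n (⋃ a ∈ S, B a) (B t) := by
  induction hn : S.ncard using Nat.strong_induction_on generalizing S t with
  | _ n ih =>
  by_cases hS1 : S ⊆ {t}
  · have : S = {t} := Set.Subset.antisymm hS1 (by simpa using ht)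
    subst this
    exact ⟨1, by simpa using .bag (hgood t)⟩
  obtain ⟨a, haS, hat⟩ := Set.not_subset.1 hS1
  obtain ⟨t', htt', hat'⟩ := SimpleGraph.exists_adj_mem_side hT.connected (t := t) (Ne.symm hat)
  have hd := SimpleGraph.disjoint_side hT.isAcyclic htt'
  obtain ⟨-, ht'⟩ := hS.mem_ends hT htt' ht haS SimpleGraph.mem_side_self hat'
  have hlt : ∀ {b c : ι}, b ∈ S → b ∉ T.side c b → (S ∩ T.side c b).ncard < n := by
    intro b c hb hb'
    rw [← hn]
    exact Set.ncard_lt_ncard ⟨Set.inter_subset_left, fun h => hb' (h hb).2⟩ (Set.toFinite _)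
  obtain ⟨m₁, h₁⟩ := ih _ (hlt ht' (Set.disjoint_right.1 hd SimpleGraph.mem_side_self))
    (hS.inter_side hT htt' ht) ⟨ht, SimpleGraph.mem_side_self⟩ rfl
  obtain ⟨m₂, h₂⟩ := ih _ (hlt ht (Set.disjoint_left.1 hd SimpleGraph.mem_side_self))
    (hS.inter_side hT htt'.symm ht') ⟨ht', SimpleGraph.mem_side_self⟩ rfl
  have hU : (⋃ a ∈ S, B a) =
      (⋃ a ∈ S ∩ T.side t t', B a) ∪ ⋃ a ∈ S ∩ T.side t' t, B a := by
    rw [← Set.biUnion_union, ← Set.inter_union_distrib_left, Set.inter_eq_self_of_subset_left]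
    exact fun a _ => SimpleGraph.mem_side_or hT.connected t t' a
  have hends : ∀ {p a b}, p ∈ B a → p ∈ B b → a ∈ T.side t t' → b ∈ T.side t' t →
      p ∈ B t ∩ B t' := fun ha hb ha' hb' => (hB _).mem_ends hT htt' ha hb ha' hb'
  have hsub : (⋃ a ∈ S ∩ T.side t t', B a) ∩ (⋃ a ∈ S ∩ T.side t' t, B a) ⊆ B t ∩ B t' := by
    rintro p ⟨hp, hp'⟩
    simp only [Set.mem_iUnion] at hp hp'
    obtain ⟨a, ha, hpa⟩ := hp
    obtain ⟨b, hb, hpb⟩ := hp'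
    exact hends hpa hpb ha.2 hb.2
  have hcross : ∀ x y, part x ∈ (⋃ a ∈ S ∩ T.side t t', B a) \ (⋃ a ∈ S ∩ T.side t' t, B a) →
      part y ∈ (⋃ a ∈ S ∩ T.side t' t, B a) \ (⋃ a ∈ S ∩ T.side t t', B a) → w x y = ⊤ := by
    rintro x y ⟨hx, hx'⟩ ⟨hy, hy'⟩
    by_contra hxy
    obtain ⟨b, hxb, hyb⟩ := hedge x y hxy
    simp only [Set.mem_iUnion, not_exists] at hx hx' hy hy'
    obtain ⟨a, ha, hxa⟩ := hx
    obtain ⟨a', ha', hya'⟩ := hy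
    rcases SimpleGraph.mem_side_or hT.connected t t' b with hb | hb
    · exact hy' t ⟨ht, SimpleGraph.mem_side_self⟩ (hends hyb hya' hb ha'.2).1
    · exact hx' t' ⟨ht', SimpleGraph.mem_side_self⟩ (hends hxa hxb ha.2 hb).2
  refine ⟨m₁ + m₂, ?_⟩
  rw [hU]
  refine .glue h₁ h₂ hsub ((Set.ncard_le_ncard hsub (Set.toFinite _)).trans_lt (hk t t' htt'))
    (separated_ofWeight hcross) (convex_ofWeight hcross htri hδ
      fun x y hx hy => hcl t t' htt' x y (hsub hx) (hsub hy)) ?_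
  rw [Set.union_comm]
  refine convex_ofWeight (fun x y hx hy => by rw [hw]; exact hcross y x hy hx) htri hδ ?_
  rw [Set.inter_comm]
  exact fun x y hx hy => hcl t t' htt' x y (hsub hx) (hsub hy)

end RouteSystem

/-! ### Weighted graphs, colourings and torsos. -/

namespace WeightedGraph

variable {V V' ι : Type u}

theorem dist_self (G : WeightedGraph V) (x : V) : G.dist x x = 0 :=
  le_antisymm ((iInf_le _ SimpleGraph.Walk.nil).trans (by simp [walkLength])) zero_le

theorem dist_triangle (G : WeightedGraph V) (x y z : V) :
    G.dist x z ≤ G.dist x y + G.dist y z :=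
  ENNReal.le_iInf_add_iInf fun p q =>
    (iInf_le _ (p.append q)).trans (by simp [walkLength])

theorem dist_le_weight (G : WeightedGraph V) {x y : V} (h : G.Adj x y) :
    G.dist x y ≤ G.weight s(x, y) :=
  (iInf_le _ (SimpleGraph.Walk.cons h .nil)).trans (by simp [walkLength])

theorem exists_walk_of_dist_le [Finite V] (G : WeightedGraph V) {x y : V} {L : ℝ≥0∞}
    (hL : L ≠ ⊤) (h : G.dist x y ≤ L) :
    ∃ p : G.toSimpleGraph.Walk x y, G.walkLength p ≤ L := by
  classical
  have := Fintype.ofFinite V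
  rw [dist_eq_iInf_path] at h
  rcases isEmpty_or_nonempty (G.toSimpleGraph.Path x y) with hE | hN
  · rw [iInf_of_empty, top_le_iff] at h
    exact absurd h hL
  · obtain ⟨p, hp⟩ := exists_eq_ciInf_of_finite
      (f := fun p : G.toSimpleGraph.Path x y => G.walkLength p.1)
    exact ⟨p.1, hp.le.trans h⟩

theorem reach_of_walk (G : WeightedGraph V') {w : V → V → ℝ≥0∞} {W : Set V} (e : V' → V)
    (he : ∀ a, e a ∈ W) (hw : ∀ a b, G.Adj a b → w (e a) (e b) ≤ G.weight s(a, b)) {x y : V'}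
    (p : G.toSimpleGraph.Walk x y) (hp : G.walkLength p ≠ ⊤) :
    Reach w W (G.walkLength p) (e x) (e y) := by
  induction p with
  | nil => exact .nil (he _)
  | @cons a b _ h p ih =>
    have hlen : G.walkLength (.cons h p) = G.weight s(a, b) + G.walkLength p := by
      simp [walkLength]
    rw [hlen] at hp ⊢
    exact .cons (he _) (ne_top_of_le_ne_top (ne_top_of_le_ne_top hp le_self_add) (hw _ _ h))
      (ih (ne_top_of_le_ne_top hp le_add_self)) (add_le_add_left (hw _ _ h) _)

theorem reach_of_dist_le [Finite V'] (G : WeightedGraph V') {w : V → V → ℝ≥0∞} {W : Set V}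
    (e : V' → V) (he : ∀ a, e a ∈ W)
    (hw : ∀ a b, G.Adj a b → w (e a) (e b) ≤ G.weight s(a, b)) {x y : V'} {L : ℝ≥0∞}
    (hL : L ≠ ⊤) (h : G.dist x y ≤ L) : Reach w W L (e x) (e y) := by
  obtain ⟨p, hp⟩ := G.exists_walk_of_dist_le hL h
  exact (G.reach_of_walk e he hw p (ne_top_of_le_ne_top hL hp)).mono subset_rfl hp

/-- The points reachable from `x` by such steps form a monochromatic set connected in the power; by
finiteness it lies in a maximal one. -/
theorem IsColouring.dist_le [Finite V] {G : WeightedGraph V} {m : ℕ} {r d : ℝ} {c : V → Fin m}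
    (h : G.IsColouring m r d c) {x y : V}
    (hxy : Relation.ReflTransGen (fun a b => c a = c b ∧ G.dist a b ≤ ENNReal.ofReal r) x y) :
    G.dist x y ≤ ENNReal.ofReal d := by
  let R := fun a b => c a = c b ∧ G.dist a b ≤ ENNReal.ofReal r
  let M : Set V := {z | Relation.ReflTransGen R x z}
  have hreach : ∀ z (hz : z ∈ M), ((G.power r).induce M).Reachable ⟨x, .refl⟩ ⟨z, hz⟩ := by
    intro z hz
    induction hz with
    | refl => exact .refl _
    | @tail a b ha hab ih =>
      refine ih.trans ?_
      by_cases hne : a = b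
      · subst hne; exact .refl _
      · exact SimpleGraph.Adj.reachable (show (G.power r).Adj a b from ⟨hne, hab.2⟩)
  have hcol : ∀ z ∈ M, c z = c x := by
    intro z hz
    induction hz with
    | refl => rfl
    | tail _ hab ih => exact hab.1.symm.trans ih
  have hM : (∀ z ∈ M, c z = c x) ∧ ((G.power r).induce M).Connected := by
    have : Nonempty M := ⟨⟨x, .refl⟩⟩
    exact ⟨hcol, ⟨fun a b => (hreach a a.2).symm.trans (hreach b b.2)⟩⟩
  obtain ⟨M', hMM', hM'⟩ := Finite.exists_le_maximal
    (p := fun S : Set V => (∀ z ∈ S, c z = c x) ∧ ((G.power r).induce S).Connected) hM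
  refine le_trans ?_ (h M' ⟨c x, hM'⟩)
  exact le_iSup₂_of_le x (hMM' .refl) (le_iSup₂_of_le y (hMM' hxy) le_rfl)

theorem isColouring_of_dist_le {G : WeightedGraph V} {m : ℕ} {r d : ℝ} {c : V → Fin m}
    (h : ∀ x y, Relation.ReflTransGen
      (fun a b => c a = c b ∧ G.dist a b ≤ ENNReal.ofReal r) x y →
      G.dist x y ≤ ENNReal.ofReal d) : G.IsColouring m r d c := by
  rintro M ⟨i, hM, -⟩
  refine iSup₂_le fun x hx => iSup₂_le fun y hy => h x y ?_
  have := (((G.power r).induce M).reachable_iff_reflTransGen ⟨x, hx⟩ ⟨y, hy⟩).1 (hM.2 _ _)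
  exact Relation.ReflTransGen.lift Subtype.val (fun a b hab =>
    ⟨(hM.1 a a.2).trans (hM.1 b b.2).symm,
      (show (G.power r).Adj a b from hab).2⟩) _ _ this

/-- The distance of `x` and `y` if they are adjacent or lie in a common adhesion set, and `∞`
otherwise. -/
noncomputable def torsoWeight (G : WeightedGraph V) (T : SimpleGraph ι) (B : ι → Set V)
    (x y : V) : ℝ≥0∞ :=
  open scoped Classical in
  if x ≠ y ∧ (G.Adj x y ∨ ∃ t t', T.Adj t t' ∧ (x ∈ B t ∧ x ∈ B t') ∧ y ∈ B t ∧ y ∈ B t')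
  then G.dist x y else ⊤

section torsoWeight

variable {G : WeightedGraph V} {T : SimpleGraph ι} {B : ι → Set V} {x y : V}

theorem torsoWeight_comm (G : WeightedGraph V) (T : SimpleGraph ι) (B : ι → Set V) (x y : V) :
    G.torsoWeight T B x y = G.torsoWeight T B y x := by
  have : (x ≠ y ∧ (G.Adj x y ∨
      ∃ t t', T.Adj t t' ∧ (x ∈ B t ∧ x ∈ B t') ∧ y ∈ B t ∧ y ∈ B t')) ↔
      (y ≠ x ∧ (G.Adj y x ∨
      ∃ t t', T.Adj t t' ∧ (y ∈ B t ∧ y ∈ B t') ∧ x ∈ B t ∧ x ∈ B t')) := by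
    rw [ne_comm, G.adj_comm]
    simp only [and_comm (a := x ∈ B _ ∧ x ∈ B _)]
  classical
  unfold torsoWeight
  rw [G.dist_comm x y]
  exact if_congr this rfl rfl

theorem dist_le_torsoWeight (x y : V) : G.dist x y ≤ G.torsoWeight T B x y := by
  unfold torsoWeight
  split_ifs
  · exact le_rfl
  · exact le_top

theorem torsoWeight_of_adj (h : G.Adj x y) : G.torsoWeight T B x y = G.dist x y :=
  if_pos ⟨h.ne, .inl h⟩

theorem torsoWeight_of_mem {t t' : ι} (ht : T.Adj t t') (hne : x ≠ y) (hx : x ∈ B t)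
    (hx' : x ∈ B t') (hy : y ∈ B t) (hy' : y ∈ B t') : G.torsoWeight T B x y = G.dist x y :=
  if_pos ⟨hne, .inr ⟨t, t', ht, ⟨hx, hx'⟩, hy, hy'⟩⟩

theorem of_torsoWeight_ne_top (h : G.torsoWeight T B x y ≠ ⊤) : x ≠ y ∧ (G.Adj x y ∨
    ∃ t t', T.Adj t t' ∧ (x ∈ B t ∧ x ∈ B t') ∧ y ∈ B t ∧ y ∈ B t') := by
  by_contra hcon
  exact h (if_neg hcon)

/-- Inside a bag, the finite values of `torsoWeight` belong to edges of the torso. -/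
theorem torso_adj_of_torsoWeight_ne_top [Finite V] (hT : T.IsTree)
    (hB : ∀ x, T.ConnectedOn {t | x ∈ B t}) {t : ι} {x y : B t}
    (h : G.torsoWeight T B x y ≠ ⊤) : (G.torso T B t).Adj x y := by
  obtain ⟨hne, h | ⟨a, a', haa', hx, hy⟩⟩ := of_torsoWeight_ne_top h
  · exact ⟨fun h => hne (congrArg _ h), .inl h⟩
  refine ⟨fun h => hne (congrArg _ h), .inr ?_⟩
  by_cases hta : t = a
  · subst hta
    exact ⟨a', haa', hx.2, hy.2⟩
  -- The adhesion set may belong to a tree edge far from `t`; connectedness puts both vertices into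
  -- the bag of the neighbour `t'` of `t` in that direction.
  · obtain ⟨t', htt', hat'⟩ := SimpleGraph.exists_adj_mem_side hT.connected hta
    exact ⟨t', htt',
      ((hB x).mem_ends hT htt' x.2 hx.1 SimpleGraph.mem_side_self hat').2,
      ((hB y).mem_ends hT htt' y.2 hy.1 SimpleGraph.mem_side_self hat').2⟩

theorem torsoWeight_le_weight_torso [Finite V] {t : ι} {x y : B t}
    (h : (G.torso T B t).Adj x y) :
    G.torsoWeight T B x y ≤ (G.torso T B t).weight s(x, y) := by
  obtain ⟨hne, h | ⟨t', ht, hx, hy⟩⟩ := h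
  · exact (torsoWeight_of_adj h).le
  · exact (torsoWeight_of_mem ht (fun h => hne (Subtype.ext h)) x.2 hx y.2 hy).le

end torsoWeight

theorem IsPartition.exists_part {G : WeightedGraph V} {P : Set (Set V)} (h : G.IsPartition P) :
    ∃ part : V → P, ∀ x (X : P), part x = X ↔ x ∈ X.1 := by
  choose S hS hS' using h.isPartition.2
  refine ⟨fun x => ⟨S x, (hS x).1⟩, fun x X => ⟨?_, fun hx => ?_⟩⟩
  · rintro rfl
    exact (hS x).2
  · exact Subtype.ext (hS' x X ⟨X.2, hx⟩).symm

theorem exists_dist_le_of_radius_le [Finite V] [Nonempty V] {G : WeightedGraph V} {L : ℝ≥0∞}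
    (h : G.radius ≤ L) : ∃ x, ∀ y, G.dist x y ≤ L := by
  obtain ⟨x, hx⟩ := exists_eq_ciInf_of_finite (f := fun x : V => ⨆ y : V, G.dist x y)
  exact ⟨x, fun y => (le_iSup (fun y => G.dist x y) y).trans (hx.le.trans h)⟩

end WeightedGraph

theorem mem_unionOfParts_iff {V : Type u} {P : Set (Set V)} {part : V → P}
    (h : ∀ x (X : P), part x = X ↔ x ∈ X.1) {Q : Set P} {x : V} :
    x ∈ unionOfParts Q ↔ part x ∈ Q := by
  constructor
  · rintro ⟨X, hX, hx⟩
    rwa [(h x X).2 hx]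
  · exact fun hx => ⟨part x, hx, (h x _).1 rfl⟩

namespace WeightedGraph

variable {V ι : Type u}

/-- A control function for `H`, extended to all real numbers, bounds the part colourings of the bags
of a strong construction. -/
theorem IsStrongConstruction.exists_bdd_bag [Finite V] {k : ℕ} {ℓ : ℝ}
    {H : WeightedGraphClass.{u}} {G : WeightedGraph V} {P : Set (Set V)} {T : SimpleGraph ι}
    {B : ι → Set P} (hs : IsStrongConstruction k ℓ H G P T B) {part : V → P}
    (hpart : ∀ x (X : P), part x = X ↔ x ∈ X.1) {centre : P → V}
    (hpc : ∀ p, part (centre p) = p) (hℓ : 0 ≤ ℓ) {w : V → V → ℝ≥0∞}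
    (hwdef : w = G.torsoWeight T fun t => unionOfParts (B t))
    {hw : ∀ x y, w x y = w y x}
    {hc : ∀ x, Reach w (part ⁻¹' {part x}) (ENNReal.ofReal ℓ) x (centre (part x))}
    {n m : ℕ} (hnm : n + 1 ≤ m) {f : PosReal → PosReal} (hf : H.Admits ℓ n f) (t : ι) :
    ∀ Y ⊆ B t, ∀ s : ℝ, ∀ hs : 0 < s, ℓ ≤ s → ∃ c : P → Fin m,
      (RouteSystem.ofWeight w hw part centre hpc hℓ hc).Bdd Y Y s c (f ⟨s, hs⟩) := by
  classical
  intro Y hY s hs0 hℓs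
  obtain ⟨c, hcol⟩ := hf _ _ (hs.mem t Y hY) ⟨s, hs0⟩ hℓs
  have hmem : ∀ {Q : Set P} {x : V}, x ∈ unionOfParts Q ↔ part x ∈ Q := mem_unionOfParts_iff hpart
  have hB : ∀ x : V, T.ConnectedOn {t | x ∈ unionOfParts (B t)} := by
    intro x
    have := SimpleGraph.connectedOn_of_induce (hs.isTreeDecomposition.connected (part x))
    simpa only [hmem] using this
  let e : (part ⁻¹' Y) → {x : unionOfParts (B t) | x.1 ∈ unionOfParts Y} :=
    fun x => ⟨⟨x, hmem.2 (hY x.2)⟩, hmem.2 x.2⟩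
  let G' := (G.torso T (fun s => unionOfParts (B s)) t).induced {x | x.1 ∈ unionOfParts Y}
  have hdist : ∀ {L : ℝ≥0∞} {x y : V} (hx : x ∈ part ⁻¹' Y) (hy : y ∈ part ⁻¹' Y),
      Reach w (part ⁻¹' Y) L x y → G'.dist (e ⟨x, hx⟩) (e ⟨y, hy⟩) ≤ L := by
    intro L x y hx hy h
    refine h.le_of_triangle e G'.dist_self G'.dist_triangle (fun x y hxy => ?_) hx hy
    rw [hwdef] at hxy ⊢
    have hadj : G'.Adj (e x) (e y) := torso_adj_of_torsoWeight_ne_top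
      (B := fun t => unionOfParts (B t)) hs.isTreeDecomposition.isTree hB
      (x := (e x).1) (y := (e y).1) hxy
    have : G.torsoWeight T (fun t => unionOfParts (B t)) x y = G.dist x y := by
      exact if_pos (of_torsoWeight_ne_top hxy)
    rw [this]
    exact G'.dist_le_weight hadj
  -- A part receives the colour of its centre. The default colour outside `Y` plays no role, as
  -- chains stay in `Y`.
  refine ⟨fun p => if h : p ∈ Y then
    Fin.castLE hnm (c (e ⟨centre p, by rwa [Set.mem_preimage, hpc]⟩)) else ⟨0, by omega⟩, ?_⟩
  intro p q hp hpq
  have hcen : ∀ {p}, p ∈ Y → centre p ∈ part ⁻¹' Y := by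
    intro p hp
    rwa [Set.mem_preimage, hpc]
  have hchain : ∀ hq : q ∈ Y, Relation.ReflTransGen
      (fun a b => c a = c b ∧ G'.dist a b ≤ ENNReal.ofReal s)
      (e ⟨centre p, hcen hp⟩) (e ⟨centre q, hcen hq⟩) := by
    induction hpq with
    | refl => exact fun _ => .refl
    | @tail a b _ hab ih =>
      obtain ⟨ha, hb, hcol', -, hreach⟩ := hab
      refine fun _ => (ih ha).tail ⟨?_, hdist _ _ hreach⟩
      simpa only [dif_pos ha, dif_pos hb, (Fin.castLE_injective hnm).eq_iff] using hcol'
  have hle := hcol.dist_le (hchain (RouteSystem.Conn.mem _ hpq hp))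
  refine ⟨(f ⟨s, hs0⟩).2.le, ?_⟩
  exact G'.reach_of_dist_le (fun a => a.1.1) (fun a => hmem.1 a.2)
    (fun a b hab => by rw [hwdef]; exact torsoWeight_le_weight_torso hab)
    ENNReal.ofReal_ne_top hle

end WeightedGraph

/-! ### The theorem. -/

theorem mainTheorem6 (k : ℕ) (f : PosReal → PosReal) :
    ∃ fk : PosReal → PosReal,
      (∀ (n : ℕ) (ℓ : ℝ), 0 ≤ ℓ →
        ∀ H : WeightedGraphClass.{u}, H.Admits ℓ n f →
          ∀ (V : Type u) [Finite V] (G : WeightedGraph V),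
            G.IsStronglyConstructable k ℓ H →
              WeightedGraph.IsAlmostControlFunction ℓ (max n 1) fk G) ∧
      (IsDilation f → IsDilation fk) := by
  let g : ℝ → ℝ := fun s => if h : 0 < s then f ⟨s, h⟩ else 1
  have hgf : ∀ s (hs : 0 < s), g s = f ⟨s, hs⟩ := fun s hs => dif_pos hs
  have hg : ∀ s, 0 < s → 0 < g s := fun s hs => by rw [hgf s hs]; exact (f ⟨s, hs⟩).2
  have hpos : ∀ r : PosReal, 0 < RouteSystem.gluedBound g (k + 1) (3 * r) := fun r =>
    RouteSystem.gluedBound_pos hg (k + 1) (mul_pos three_pos r.2)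
  -- Vertices at distance at most `r` have centres within `r + 2 * ℓ ≤ 3 * r`, and `2 * r` pays for
  -- the way back from centres to vertices. The index is `k + 1` because `Glued` bounds adhesion
  -- strictly.
  refine ⟨fun r => ⟨RouteSystem.gluedBound g (k + 1) (3 * r) + 2 * r,
    add_pos (hpos r) (mul_pos two_pos r.2)⟩, ?_, ?_⟩
  · rintro n ℓ hℓ H hf V _ G ⟨P, ι, _, T, B, hs⟩ r hr
    obtain ⟨part, hpart⟩ := hs.isPartition.exists_part
    have hmem : ∀ {Q : Set P} {x : V}, x ∈ unionOfParts Q ↔ part x ∈ Q :=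
      mem_unionOfParts_iff hpart
    have hcentre : ∀ p : P, ∃ x : p.1, ∀ y, (G.induced p.1).dist x y ≤ ENNReal.ofReal ℓ := by
      intro p
      have : Nonempty p.1 := (hs.isPartition.connected p.1 p.2).nonempty
      exact WeightedGraph.exists_dist_le_of_radius_le (hs.isShallow p.1 p.2)
    choose centre hcentre using hcentre
    have hpc : ∀ p, part (centre p) = p := fun p => (hpart _ p).2 (centre p).2
    obtain ⟨w, hwdef⟩ : ∃ w, w = G.torsoWeight T fun t => unionOfParts (B t) := ⟨_, rfl⟩
    have hw : ∀ x y, w x y = w y x := by rw [hwdef]; exact G.torsoWeight_comm T _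
    have hδ : ∀ x y, G.dist x y ≤ w x y := by
      rw [hwdef]; exact WeightedGraph.dist_le_torsoWeight
    have hwG : ∀ x y, G.Adj x y → w x y ≤ G.weight s(x, y) := by
      intro x y h
      rw [hwdef, WeightedGraph.torsoWeight_of_adj h]
      exact G.dist_le_weight h
    have hc : ∀ x, Reach w (part ⁻¹' {part x}) (ENNReal.ofReal ℓ) x (centre (part x)) := by
      intro x
      refine Reach.symm hw ?_
      exact (G.induced (part x).1).reach_of_dist_le Subtype.val (fun a => (hpart _ _).2 a.2)
        (fun a b h => hwG _ _ h) ENNReal.ofReal_ne_top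
        (hcentre (part x) ⟨x, (hpart x _).1 rfl⟩)
    -- Two distinct colours for the rings exist because of `max n 1`.
    have hne : (⟨0, by omega⟩ : Fin (max n 1 + 1)) ≠ ⟨1, by omega⟩ := by simp
    have hT := hs.isTreeDecomposition.isTree
    have hB : ∀ p, T.ConnectedOn {t | p ∈ B t} := fun p =>
      SimpleGraph.connectedOn_of_induce (hs.isTreeDecomposition.connected p)
    have hbag : ∀ p, ∃ t, p ∈ B t := fun p =>
      let ⟨t⟩ := (hs.isTreeDecomposition.connected p).nonempty
      ⟨t, t.2⟩
    obtain ⟨t⟩ := hT.connected.nonempty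
    have hglued : ∃ m, (RouteSystem.ofWeight w hw part (fun p => centre p) hpc hℓ hc).Glued
        (fun X => ∀ Y ⊆ X, ∀ s, 0 < s → ℓ ≤ s → ∃ c : P → Fin (max n 1 + 1),
          (RouteSystem.ofWeight w hw part (fun p => centre p) hpc hℓ hc).Bdd Y Y s c (g s))
        (k + 1) m (⋃ a ∈ Set.univ, B a) (B t) := by
      refine RouteSystem.exists_glued_of_tree hT hB ?_ G.dist_triangle hδ ?_ ?_ ?_ ?_
        (Set.mem_univ t)
      · intro x y hxy
        rw [hwdef] at hxy
        obtain ⟨-, h | ⟨a, a', -, hx, hy⟩⟩ := WeightedGraph.of_torsoWeight_ne_top hxy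
        · by_cases hp : part x = part y
          · obtain ⟨a, ha⟩ := hbag (part x)
            exact ⟨a, ha, hp ▸ ha⟩
          · exact hs.isTreeDecomposition.exists_bag _ _
              ⟨hp, x, (hpart x _).1 rfl, y, (hpart y _).1 rfl, h⟩
        · exact ⟨a, hmem.1 hx.1, hmem.1 hy.1⟩
      · intro a a' haa' x y hx hy hxy
        rw [hwdef]
        exact (WeightedGraph.torsoWeight_of_mem haa' hxy (hmem.2 hx.1) (hmem.2 hx.2) (hmem.2 hy.1)
          (hmem.2 hy.2)).le
      · intro a a' haa'
        exact Nat.lt_succ_of_le (Set.encard_le_coe_iff_finite_ncard_le.1 (hs.adhesion a a' haa')).2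
      · intro a Y hY s hs0 hℓs
        rw [hgf s hs0]
        exact hs.exists_bdd_bag hpart hpc hℓ hwdef (by omega) hf a Y hY s hs0 hℓs
      · intro a _ b _
        have := (T.reachable_iff_reflTransGen a b).1 (hT.connected a b)
        exact Relation.ReflTransGen.mono (fun x y h => ⟨h, trivial, trivial⟩) _ _ this
    obtain ⟨m, hglued⟩ := hglued
    have huniv : (⋃ a ∈ Set.univ, B a) = Set.univ := by
      refine Set.eq_univ_of_forall fun p => ?_
      obtain ⟨a, ha⟩ := hbag p
      exact Set.mem_biUnion (Set.mem_univ a) ha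
    rw [huniv] at hglued
    have hr0 : (0 : ℝ) < r := r.2
    obtain ⟨c, hbdd⟩ := hglued.exists_bdd hne hg (k + 1) (r := 3 * r)
      (mul_pos three_pos hr0) (by linarith)
    refine ⟨fun x => c (part x), WeightedGraph.isColouring_of_dist_le fun x y hxy => ?_⟩
    have hcU : ∀ x, Reach w (part ⁻¹' Set.univ) (ENNReal.ofReal ℓ) x (centre (part x)) :=
      fun x => (hc x).mono (Set.preimage_mono (Set.subset_univ _)) le_rfl
    have hconn : (RouteSystem.ofWeight w hw part (fun p => centre p) hpc hℓ hc).Conn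
        Set.univ Set.univ (3 * r) c (part x) (part y) := by
      refine Relation.ReflTransGen.lift part (fun a b hab => ?_) _ _ hxy
      refine ⟨trivial, trivial, hab.1, by linarith, ?_⟩
      have h := G.reach_of_dist_le (w := w) (W := part ⁻¹' Set.univ) id (fun _ => trivial) hwG
        ENNReal.ofReal_ne_top hab.2
      refine ((((hcU a).symm hw).trans h).trans (hcU b)).mono subset_rfl ?_
      rw [← ENNReal.ofReal_add hℓ hr0.le, ← ENNReal.ofReal_add (by linarith) hℓ]
      exact ENNReal.ofReal_le_ofReal (by linarith)
    obtain ⟨-, h⟩ := hbdd _ _ trivial hconn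
    have h' := ((hcU x).trans h).trans ((hcU y).symm hw)
    have hle := h'.le_of_triangle Subtype.val G.dist_self G.dist_triangle
      (fun a b _ => hδ a b) trivial trivial
    refine hle.trans ?_
    rw [← ENNReal.ofReal_add hℓ (hpos r).le,
      ← ENNReal.ofReal_add (add_nonneg hℓ (hpos r).le) hℓ]
    exact ENNReal.ofReal_le_ofReal (by linarith)
  · rintro ⟨b, hb, hfb⟩
    obtain ⟨d, hd, hle⟩ := RouteSystem.gluedBound_le hg hb
      (fun s hs => by rw [hgf s hs]; exact hfb ⟨s, hs⟩) (k + 1)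
    refine ⟨3 * d + 2, by positivity, fun r => ?_⟩
    have := hle (3 * r) (mul_pos three_pos r.2)
    show RouteSystem.gluedBound g (k + 1) (3 * r) + 2 * r ≤ (3 * d + 2) * r
    linarith
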